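/- All graphs are finite, undirected and simple. For an integer $s\ge 0$, let $sP_1+P_3$ denote the disjoint union of $s$ isolated vertices and a path on three vertices; a graph is $(sP_1+P_3)$-free if it has no induced subgraph isomorphic to $sP_1+P_3$. For a graph $G=(V,E)$ and $T\subseteq V$, a set $S_T\subseteq V$ is a $T$-feedback vertex set of $G$ if every cycle of $G$ that contains a vertex of $T$ contains a vertex of $S_T$. The problem Subset Feedback Vertex Set takes as input a graph $G=(V,E)$, a subset $T\subseteq V$ and a positive integer $k$, and asks whether $G$ has a $T$-feedback vertex set $S_T$ with $|S_T|\le k$. **Theorem.** For every integer $s\ge 0$, Subset Feedback Vertex Set can be solved in polynomial time for $(sP_1+P_3)$-free graphs. That is, for every $s \ge 0$ there are a Turing machine and a polynomial $p$ such that on every input $(G,T,k)$ in which $G$ is $(sP_1+P_3)$-free, encoded as a word of length $\ell$ (the characteristic vector of $T$, the adjacency matrix of $G$, and $k$ in binary), the machine halts after at most $p(\ell)$ steps with the correct answer. -/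

import Mathlib

open Computability

/-- The graph `sP₁ + P₃`: the disjoint union of `s` isolated vertices and a path on three vertices. -/
abbrev sP1P3 (s : ℕ) : SimpleGraph (Fin s ⊕ Fin 3) :=
  (⊥ : SimpleGraph (Fin s)) ⊕g SimpleGraph.pathGraph 3

/-- `G` is `H`-free: `G` has no induced subgraph isomorphic to `H`. -/
def IsFreeOf {V W : Type*} (H : SimpleGraph W) (G : SimpleGraph V) : Prop :=
  ¬ H.IsIndContained G

/-- `S` is a `T`-feedback vertex set of `G`: every cycle of `G` that contains a vertex of `T`
contains a vertex of `S`. -/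
def IsSubsetFVS {V : Type*} (G : SimpleGraph V) (T S : Finset V) : Prop :=
  ∀ (v : V) (c : G.Walk v v), c.IsCycle → (∃ t ∈ c.support, t ∈ T) → ∃ x ∈ c.support, x ∈ S

/-- An instance `(G, T, k)` of Subset Feedback Vertex Set: a finite simple graph `G` (presented on
the vertex set `{0, …, n - 1}`), a set `T` of vertices and a positive integer `k`. -/
structure SFVSInstance where
  n : ℕ
  G : SimpleGraph (Fin n)
  T : Finset (Fin n)
  k : ℕ
  k_pos : 0 < k

namespace SFVSInstance

/-- The question of the problem: is there a `T`-feedback vertex set of size at most `k`? -/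
def IsYes (I : SFVSInstance) : Prop :=
  ∃ S : Finset (Fin I.n), IsSubsetFVS I.G I.T S ∧ S.card ≤ I.k

/-- The words over `{0, 1}` that describe an instance: the characteristic vector of `T`, the rows
of the adjacency matrix of `G`, and the number `k` in binary. -/
noncomputable def words (I : SFVSInstance) : List (List Bool) :=
  open Classical in
  ((List.finRange I.n).map fun i => decide (i ∈ I.T)) ::
    ((List.finRange I.n).map fun i => (List.finRange I.n).map fun j => decide (I.G.Adj i j)) ++
    [encodeNat I.k]

end SFVSInstance

/-- A list of words over `{0, 1}` as a single word, each of them followed by a comma. -/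
def encodeWords (ws : List (List Bool)) : List Γ' :=
  ws.flatMap fun w => w.map Γ'.bit ++ [Γ'.comma]

/-- The input word of an instance of Subset Feedback Vertex Set. -/
noncomputable def SFVSInstance.encode (I : SFVSInstance) : List Γ' :=
  encodeWords I.words

theorem encodeWords_injective : Function.Injective encodeWords := by
  have key : ∀ (a b : List Bool) (x y : List Γ'),
      a.map Γ'.bit ++ Γ'.comma :: x = b.map Γ'.bit ++ Γ'.comma :: y → a = b ∧ x = y := by
    intro a
    induction a with
    | nil => intro b x y h; cases b <;> simp_all
    | cons c a ih =>
      intro b x y h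
      cases b with
      | nil => simp at h
      | cons d b =>
        simp only [List.map_cons, List.cons_append, List.cons.injEq, Γ'.bit.injEq] at h
        obtain ⟨h1, h2⟩ := ih b x y h.2
        exact ⟨by rw [h.1, h1], h2⟩
  intro a
  induction a with
  | nil => intro b h; cases b <;> simp_all [encodeWords]
  | cons w a ih =>
    intro b h
    cases b with
    | nil => simp [encodeWords] at h
    | cons w' b =>
      simp only [encodeWords, List.flatMap_cons, List.append_assoc, List.singleton_append] at h
      obtain ⟨h1, h2⟩ := key _ _ _ _ h
      rw [h1, ih h2]

/-- Different instances have different input words. -/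
theorem SFVSInstance.encode_injective : Function.Injective SFVSInstance.encode := by
  intro I J h
  have hw : I.words = J.words := encodeWords_injective h
  obtain ⟨n, G, T, k, hk⟩ := I
  obtain ⟨m, G', T', k', hk'⟩ := J
  simp only [SFVSInstance.words, List.cons_append, List.cons.injEq] at hw
  obtain ⟨hT, hR⟩ := hw
  have hn : n = m := by simpa using congrArg List.length hT
  subst hn
  obtain ⟨hG, hk2⟩ := List.append_inj hR (by simp)
  have hT2 : T = T' := by
    ext i
    have := (List.map_inj_left.1 hT) i (List.mem_finRange i)
    simpa using this
  have hG2 : G = G' := by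
    ext i j
    have h1 := (List.map_inj_left.1 hG) i (List.mem_finRange i)
    have h2 := (List.map_inj_left.1 h1) j (List.mem_finRange j)
    simpa using h2
  have hk3 : k = k' := by
    have h1 : encodeNat k = encodeNat k' := by simpa using hk2
    simpa using congrArg decodeNat h1
  subst hT2 hG2 hk3
  rfl

/-- Polynomial-time solvability of a decision problem on a class of instances: some Turing machine
halts on (the input word of) every instance `a` in the class `C` after a number of steps that is
polynomial in the length of the input word, with the correct answer to the question `Q a` as its
output. Nothing is asked of the machine on other inputs. -/
def PolyTimeSolvableOn {α Γ : Type} (enc : α → List Γ) (C Q : α → Prop) : Prop :=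
  open Classical in
  Nonempty (Turing.TM2ComputableInPolyTime (fun a : {a : α // C a} => enc a.1) encodeBool
    (fun a => decide (Q a.1)))

/-! The proof writes the question, for fixed `s`, as one first-order sentence over the graph with
the predicate `T`, the vertex order, and a quantifier "at most `k` vertices satisfy". Such a
sentence is evaluated in polynomial time by nested loops over the vertices
(`polyTimeSolvableOn_formula`). The loops are counter programs with unary registers, and a compiler
turns these into Turing machines with the same step count, apart from one final halting step
(`Exec.steps`).

On the graph side, let `F` be the complement of a solution. If `F` contains at most `(s+3)²`
vertices of `T`, then either `F` differs from the complement of `T` in boundedly many vertices, or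
deleting exactly `T` is cheaper (`exists_smallSolution`). The differing vertices can be guessed.
Whether a guess works is first-order, because shortest walks in an `(sP₁+P₃)`-free graph have length
at most `2s+2` (`reach_of_reflTransGen`).

If `F` contains at least `(s+3)²` vertices of `T`, then some `r` in `F` leaves a disjoint union of
cliques when removed, and `F - r` contains `s` independent vertices of `T` (`exists_center`). The
cliques of `F - r` meeting these have at most two vertices each, hence at most `2s` in all
(`exists_closed_superset`). Guess `r` and these vertices `w`. Among the vertices of the whole graph
that are distinct from `r` and neither equal nor adjacent to any `w j`, there is no induced `P₃`,
since it would complete an `sP₁+P₃`. These free vertices thus form disjoint cliques with no edge to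
`w`, and an optimal choice can be made in each clique separately, by a definable rule (`Sel`). The
result has no `T`-cycle because cliques plus one vertex have a `T`-cycle only if they have a
`T`-triangle (`noTCycle_of_p3Free`), and it is at least as large as `F` (`ncard_not_kept_le`). -/

namespace SubsetFVS

/-! ### Counter programs and their step-counting semantics -/

/-- The data of a counter program: a tape (split at the head into `aux`, reversed, and `inp`),
an output word, and registers holding natural numbers. -/
structure Store (R : Type) where
  inp : List Γ'
  aux : List Γ'
  out : List Bool
  reg : R → ℕ

/-- The elementary actions of a counter program. -/
inductive Act (R : Type)
  | nop
  | right
  | left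
  | erase
  | write (b : Bool)
  | inc (r : R)
  | dec (r : R)

/-- The elementary tests of a counter program. -/
inductive Test (R : Type)
  | pos (r : R)
  | inp (p : Option Γ' → Bool)
  | aux (p : Option Γ' → Bool)

/-- Structured counter programs. -/
inductive Prog (R : Type)
  | act (a : Act R)
  | seq (p q : Prog R)
  | ite (c : Test R) (p q : Prog R)
  | loop (c : Test R) (p : Prog R)

namespace Store

variable {R : Type} [DecidableEq R]

/-- Overwrite a register. -/
def set (s : Store R) (r : R) (v : ℕ) : Store R :=
  { s with reg := Function.update s.reg r v }

end Store

section Semantics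

variable {R : Type} [DecidableEq R]

/-- The effect of an action. -/
def Act.apply : Act R → Store R → Store R
  | .nop, s => s
  | .right, s => { s with inp := s.inp.tail, aux := s.inp.head?.toList ++ s.aux }
  | .left, s => { s with aux := s.aux.tail, inp := s.aux.head?.toList ++ s.inp }
  | .erase, s => { s with inp := s.inp.tail }
  | .write b, s => { s with out := b :: s.out }
  | .inc r, s => s.set r (s.reg r + 1)
  | .dec r, s => s.set r (s.reg r - 1)

/-- The value of a test. -/
def Test.eval : Test R → Store R → Bool
  | .pos r, s => decide (0 < s.reg r)
  | .inp p, s => p s.inp.head?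
  | .aux p, s => p s.aux.head?

/-- `Exec p s s' t`: the program `p` transforms `s` into `s'` in exactly `t` steps. -/
inductive Exec : Prog R → Store R → Store R → ℕ → Prop
  | act (a : Act R) (s : Store R) : Exec (.act a) s (a.apply s) 1
  | seq {p q : Prog R} {s₁ s₂ s₃ : Store R} {t₁ t₂ : ℕ} :
      Exec p s₁ s₂ t₁ → Exec q s₂ s₃ t₂ → Exec (.seq p q) s₁ s₃ (t₁ + t₂)
  | ite_true {c : Test R} {p q : Prog R} {s s' : Store R} {t : ℕ} :
      c.eval s = true → Exec p s s' t → Exec (.ite c p q) s s' (1 + t)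
  | ite_false {c : Test R} {p q : Prog R} {s s' : Store R} {t : ℕ} :
      c.eval s = false → Exec q s s' t → Exec (.ite c p q) s s' (1 + t)
  | loop_false {c : Test R} {p : Prog R} {s : Store R} :
      c.eval s = false → Exec (.loop c p) s s 1
  | loop_true {c : Test R} {p : Prog R} {s₁ s₂ s₃ : Store R} {t₁ t₂ : ℕ} :
      c.eval s₁ = true → Exec p s₁ s₂ t₁ → Exec (.loop c p) s₂ s₃ t₂ →
      Exec (.loop c p) s₁ s₃ (1 + t₁ + t₂)

end Semantics

/-! ### Compilation of counter programs to Turing machines -/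

section Compiler

/-- The stacks of the machine that runs a counter program. -/
inductive Stk (R : Type)
  | inp
  | aux
  | out
  | reg (r : R)
  deriving DecidableEq, Fintype

/-- The stack alphabets. -/
def Alph {R : Type} : Stk R → Type
  | .inp => Γ'
  | .aux => Γ'
  | .out => Bool
  | .reg _ => Unit

/-- The stacks representing a store. -/
def Store.stk {R : Type} (s : Store R) : ∀ k : Stk R, List (Alph k)
  | .inp => s.inp
  | .aux => s.aux
  | .out => s.out
  | .reg r => List.replicate (s.reg r) ()

/-- The labels of the machine code of a program. -/
def Lab {R : Type} : Prog R → Type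
  | .act _ => Unit
  | .seq p q => Lab p ⊕ Lab q
  | .ite _ p q => Option (Lab p ⊕ Lab q)
  | .loop _ p => Option (Lab p)

instance Lab.fintype {R : Type} : ∀ p : Prog R, Fintype (Lab p)
  | .act _ => inferInstanceAs (Fintype Unit)
  | .seq p q =>
    letI := Lab.fintype p; letI := Lab.fintype q; inferInstanceAs (Fintype (Lab p ⊕ Lab q))
  | .ite _ p q =>
    letI := Lab.fintype p; letI := Lab.fintype q
    inferInstanceAs (Fintype (Option (Lab p ⊕ Lab q)))
  | .loop _ p => letI := Lab.fintype p; inferInstanceAs (Fintype (Option (Lab p)))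

/-- The label at which the code of a program starts. -/
def Lab.entry {R : Type} : ∀ p : Prog R, Lab p
  | .act _ => ()
  | .seq p _ => Sum.inl (Lab.entry p)
  | .ite _ _ _ => none
  | .loop _ _ => none

/-- Machine statements that run one action and then jump to the label `l`. -/
def Act.code {R L : Type} (l : L) : Act R → Turing.TM2.Stmt (Alph (R := R)) L (Option Γ')
  | .nop => .goto fun _ => l
  | .right => .pop .inp (fun _ o => o) <| .branch Option.isSome
      (.push .aux (fun v => (v.getD .blank : Γ')) <| .load (fun _ => none) <| .goto fun _ => l)
      (.goto fun _ => l)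
  | .left => .pop .aux (fun _ o => o) <| .branch Option.isSome
      (.push .inp (fun v => (v.getD .blank : Γ')) <| .load (fun _ => none) <| .goto fun _ => l)
      (.goto fun _ => l)
  | .erase => .pop .inp (fun v _ => v) <| .goto fun _ => l
  | .write b => .push .out (fun _ => b) <| .goto fun _ => l
  | .inc r => .push (.reg r) (fun _ => ()) <| .goto fun _ => l
  | .dec r => .pop (.reg r) (fun v _ => v) <| .goto fun _ => l

/-- The internal state recording a truth value. -/
def flag (b : Bool) : Option Γ' := if b then some .blank else none

/-- Machine statements that jump to `l₁` or `l₂` according to a test. -/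
def Test.code {R L : Type} (l₁ l₂ : L) : Test R → Turing.TM2.Stmt (Alph (R := R)) L (Option Γ')
  | .pos r => .peek (.reg r) (fun _ o => flag o.isSome) <| .branch Option.isSome
      (.load (fun _ => none) <| .goto fun _ => l₁) (.goto fun _ => l₂)
  | .inp p => .peek .inp (fun _ o => flag (p o)) <| .branch Option.isSome
      (.load (fun _ => none) <| .goto fun _ => l₁) (.goto fun _ => l₂)
  | .aux p => .peek .aux (fun _ o => flag (p o)) <| .branch Option.isSome
      (.load (fun _ => none) <| .goto fun _ => l₁) (.goto fun _ => l₂)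

/-- The machine code of a program, embedded into a machine with labels `L`; it leaves at `l`. -/
def Prog.code {R L : Type} : (p : Prog R) → (Lab p → L) → L → Lab p →
    Turing.TM2.Stmt (Alph (R := R)) L (Option Γ')
  | .act a, _, l, _ => a.code l
  | .seq p q, f, l, x => match x with
    | .inl x => p.code (f ∘ Sum.inl) (f (Sum.inr (Lab.entry q))) x
    | .inr x => q.code (f ∘ Sum.inr) l x
  | .ite c p q, f, l, x => match x with
    | none => c.code (f (some (Sum.inl (Lab.entry p)))) (f (some (Sum.inr (Lab.entry q))))
    | some (.inl x) => p.code (fun y => f (some (Sum.inl y))) l x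
    | some (.inr x) => q.code (fun y => f (some (Sum.inr y))) l x
  | .loop c p, f, l, x => match x with
    | none => c.code (f (some (Lab.entry p))) l
    | some x => p.code (fun y => f (some y)) (f none) x

variable {R : Type} [DecidableEq R]

/-- A machine reaches `c'` from `c` in exactly `t` steps. -/
def Steps {L : Type} (M : L → Turing.TM2.Stmt (Alph (R := R)) L (Option Γ')) (t : ℕ)
    (c c' : Turing.TM2.Cfg (Alph (R := R)) L (Option Γ')) : Prop :=
  (flip bind (Turing.TM2.step M))^[t] (some c) = some c'

theorem Steps.trans {L : Type} {M : L → Turing.TM2.Stmt (Alph (R := R)) L (Option Γ')}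
    {t₁ t₂ : ℕ} {c₁ c₂ c₃ : Turing.TM2.Cfg (Alph (R := R)) L (Option Γ')}
    (h₁ : Steps M t₁ c₁ c₂) (h₂ : Steps M t₂ c₂ c₃) : Steps M (t₁ + t₂) c₁ c₃ := by
  unfold Steps at *
  rw [Nat.add_comm, Function.iterate_add_apply, h₁, h₂]

theorem stk_set (s : Store R) (r : R) (v : ℕ) :
    (s.set r v).stk = Function.update s.stk (.reg r) (List.replicate v ()) := by
  funext k
  cases k with
  | reg r' =>
    by_cases h : r' = r
    · subst h; simp [Store.stk, Store.set]
    · simp [Store.stk, Store.set, h]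
  | _ => simp only [Function.update, reduceCtorEq, ↓reduceDIte]; rfl

/-- The internal state serves only as scratch space within one statement: it is `none` at every
label, which lets code fragments be composed without tracking it. -/
theorem Act.steps {L : Type} (M : L → Turing.TM2.Stmt (Alph (R := R)) L (Option Γ')) (a : Act R)
    (l₀ l : L) (h : M l₀ = a.code l) (s : Store R) :
    Steps M 1 ⟨some l₀, none, s.stk⟩ ⟨some l, none, (a.apply s).stk⟩ := by
  simp only [Steps, Function.iterate_one, flip, Option.bind_eq_bind, Option.bind_some,
    Turing.TM2.step, h]
  -- This reduces the claim to an equality of stack functions, which is then checked stack by stack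
  -- against explicit updates.
  have key : ∀ {S S' : ∀ k : Stk R, List (Alph k)}, S = S' →
      some (⟨some l, none, S⟩ : Turing.TM2.Cfg (Alph (R := R)) L (Option Γ')) =
        some ⟨some l, none, S'⟩ := fun h => by rw [h]
  obtain ⟨i, x, o, g⟩ := s
  cases a with
  | nop => rfl
  | right =>
    cases i with
    | nil =>
      refine key (S := Function.update _ Stk.inp []) ?_
      funext k; cases k <;> rfl
    | cons y i =>
      refine key (S := Function.update (Function.update _ Stk.inp i) Stk.aux (y :: x)) ?_
      funext k; cases k <;> rfl
  | left =>
    cases x with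
    | nil =>
      refine key (S := Function.update _ Stk.aux []) ?_
      funext k; cases k <;> rfl
    | cons y x =>
      refine key (S := Function.update (Function.update _ Stk.aux x) Stk.inp (y :: i)) ?_
      funext k; cases k <;> rfl
  | erase =>
    refine key (S := Function.update _ Stk.inp i.tail) ?_
    funext k; cases k <;> rfl
  | write b =>
    refine key (S := Function.update _ Stk.out (b :: o)) ?_
    funext k; cases k <;> rfl
  | inc r =>
    simp only [Act.code, Turing.TM2.stepAux, Act.apply, stk_set]
    rfl
  | dec r =>
    simp only [Act.code, Turing.TM2.stepAux, Act.apply, stk_set]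
    refine key (congrArg _ ?_)
    exact List.tail_replicate

theorem Test.steps {L : Type} (M : L → Turing.TM2.Stmt (Alph (R := R)) L (Option Γ')) (c : Test R)
    (l₀ l₁ l₂ : L) (h : M l₀ = c.code l₁ l₂) (s : Store R) :
    Steps M 1 ⟨some l₀, none, s.stk⟩ ⟨some (cond (c.eval s) l₁ l₂), none, s.stk⟩ := by
  simp only [Steps, Function.iterate_one, flip, Option.bind_eq_bind, Option.bind_some,
    Turing.TM2.step, h]
  have key : ∀ b : Bool, ∀ S : ∀ k : Stk R, List (Alph k),
      (cond (flag b).isSome (⟨some l₁, none, S⟩ : Turing.TM2.Cfg (Alph (R := R)) L (Option Γ'))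
        ⟨some l₂, flag b, S⟩) = ⟨some (cond b l₁ l₂), none, S⟩ := by
    intro b S; cases b <;> rfl
  cases c with
  | pos r =>
    simp only [Test.code, Turing.TM2.stepAux, key, Test.eval]
    congr 4
    simp only [Store.stk]
    cases s.reg r <;> rfl
  | inp p => simp only [Test.code, Turing.TM2.stepAux, key, Test.eval]; rfl
  | aux p => simp only [Test.code, Turing.TM2.stepAux, key, Test.eval]; rfl

/-- Each action and each test is exactly one machine step, so the times agree. The label embedding
`f` and the exit `l` are arbitrary because the induction applies the claim to subprograms sitting
inside a larger machine. -/
theorem Exec.steps {p : Prog R} {s s' : Store R} {t : ℕ} (h : Exec p s s' t) :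
    ∀ {L : Type} (M : L → Turing.TM2.Stmt (Alph (R := R)) L (Option Γ')) (f : Lab p → L) (l : L),
      (∀ x, M (f x) = p.code f l x) →
      Steps M t ⟨some (f (Lab.entry p)), none, s.stk⟩ ⟨some l, none, s'.stk⟩ := by
  induction h with
  | act a s => intro L M f l hM; exact a.steps M _ _ (hM ()) s
  | seq _ _ ih₁ ih₂ =>
    intro L M f l hM
    exact (ih₁ M (f ∘ Sum.inl) _ fun x => hM (.inl x)).trans
      (ih₂ M (f ∘ Sum.inr) l fun x => hM (.inr x))
  | @ite_true _ _ _ s _ _ hc _ ih =>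
    intro L M f l hM
    have h1 := Test.steps M _ _ _ _ (hM none) s
    rw [hc] at h1
    exact h1.trans (ih M (fun y => f (some (.inl y))) l fun x => hM (some (.inl x)))
  | @ite_false _ _ _ s _ _ hc _ ih =>
    intro L M f l hM
    have h1 := Test.steps M _ _ _ _ (hM none) s
    rw [hc] at h1
    exact h1.trans (ih M (fun y => f (some (.inr y))) l fun x => hM (some (.inr x)))
  | @loop_false _ _ s hc =>
    intro L M f l hM
    have h1 := Test.steps M _ _ _ _ (hM none) s
    rw [hc] at h1
    exact h1
  | @loop_true _ _ s _ _ _ _ hc _ _ ih₁ ih₂ =>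
    intro L M f l hM
    have h1 := Test.steps M _ _ _ _ (hM none) s
    rw [hc] at h1
    exact (h1.trans (ih₁ M (fun y => f (some y)) (f none) fun x => hM (some x))).trans
      (ih₂ M f l hM)

/-- The Turing machine that runs a counter program. -/
def Prog.machine [Fintype R] (p : Prog R) : Turing.FinTM2 where
  K := Stk R
  k₀ := .inp
  k₁ := .out
  Γ := Alph
  Λ := Option (Lab p)
  main := some (Lab.entry p)
  σ := Option Γ'
  initialState := none
  Γk₀Fin := inferInstanceAs (Fintype Γ')
  m := fun
    | none => .halt
    | some x => p.code some none x

/-- The store at the start of a computation. -/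
def Store.init (R : Type) (w : List Γ') : Store R := ⟨w, [], [], fun _ => 0⟩

/-- The store at the end of a computation. -/
def Store.final (R : Type) (b : Bool) : Store R := ⟨[], [], [b], fun _ => 0⟩

/-- A decision problem that is solved by a counter program in polynomial time is solved by a Turing
machine in polynomial time. -/
theorem polyTimeSolvableOn_of_prog [Fintype R] {α : Type} (enc : α → List Γ') (C Q : α → Prop)
    (p : Prog R) (P : Polynomial ℕ)
    (h : ∀ a, C a → ∀ b : Bool, (b = true ↔ Q a) →
      ∃ t ≤ P.eval (enc a).length, Exec p (.init R (enc a)) (.final R b) t) :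
    PolyTimeSolvableOn enc C Q := by
  classical
  -- The additional step executes `halt` at the exit label `none`.
  refine ⟨⟨⟨p.machine, Equiv.refl _, Equiv.refl _⟩, P + 1, ?_⟩⟩
  rintro ⟨a, ha⟩
  have hQ := h a ha (decide (Q a)) (by simp)
  let t := hQ.choose
  have ht := hQ.choose_spec
  refine ⟨⟨t + 1, ?_⟩, ?_⟩
  · have h1 := ht.2.steps p.machine.m some none (fun x => rfl)
    have h2 : Steps p.machine.m 1 ⟨some none, none, (Store.final R (decide (Q a))).stk⟩
        ⟨none, none, (Store.final R (decide (Q a))).stk⟩ := rfl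
    have h3 := h1.trans h2
    have e1 : Turing.initList p.machine (List.map (Equiv.refl Γ').invFun (enc a)) =
        ⟨some (some (Lab.entry p)), none, (Store.init R (enc a)).stk⟩ := by
      simp only [Turing.initList]
      congr 1
      funext k
      rcases k with _ | _ | _ | r
      · change List.map id (enc a) = enc a
        simp
      all_goals rfl
    have e2 : Turing.haltList p.machine
        (List.map (Equiv.refl Bool).invFun (encodeBool (decide (Q a)))) =
        ⟨none, none, (Store.final R (decide (Q a))).stk⟩ := by
      simp only [Turing.haltList]
      congr 1
      funext k
      rcases k with _ | _ | _ | r <;> rfl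
    have e3 := e1 ▸ e2 ▸ h3
    exact e3
  · simpa using ht.1

end Compiler


/-! ### Stores and arithmetic subroutines -/

namespace Store

variable {R : Type}

@[ext]
theorem ext' {s s' : Store R} (h₁ : s.inp = s'.inp) (h₂ : s.aux = s'.aux) (h₃ : s.out = s'.out)
    (h₄ : ∀ r, s.reg r = s'.reg r) : s = s' := by
  obtain ⟨_, _, _, _⟩ := s
  obtain ⟨_, _, _, _⟩ := s'
  simp only at h₁ h₂ h₃ h₄
  rw [h₁, h₂, h₃, funext h₄]

/-- Put the word `w` on the tape, with the head at position `p`. -/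
def at' (s : Store R) (w : List Γ') (p : ℕ) : Store R :=
  { s with inp := w.drop p, aux := (w.take p).reverse }

@[simp] theorem reg_at' (s : Store R) (w : List Γ') (p : ℕ) : (s.at' w p).reg = s.reg := rfl
@[simp] theorem inp_at' (s : Store R) (w : List Γ') (p : ℕ) : (s.at' w p).inp = w.drop p := rfl
@[simp] theorem out_at' (s : Store R) (w : List Γ') (p : ℕ) : (s.at' w p).out = s.out := rfl
@[simp] theorem aux_at' (s : Store R) (w : List Γ') (p : ℕ) :
    (s.at' w p).aux = (w.take p).reverse := rfl

theorem at'_zero (s : Store R) (w : List Γ') (h₁ : s.inp = w) (h₂ : s.aux = []) :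
    s.at' w 0 = s := by
  ext x <;> simp [h₁, h₂]

variable [DecidableEq R]

theorem reg_set (s : Store R) (r r' : R) (v : ℕ) :
    (s.set r v).reg r' = if r' = r then v else s.reg r' := by
  simp [set, Function.update_apply]

@[simp] theorem reg_set_self (s : Store R) (r : R) (v : ℕ) : (s.set r v).reg r = v := by
  simp [reg_set]

@[simp] theorem inp_set (s : Store R) (r : R) (v : ℕ) : (s.set r v).inp = s.inp := rfl
@[simp] theorem aux_set (s : Store R) (r : R) (v : ℕ) : (s.set r v).aux = s.aux := rfl
@[simp] theorem out_set (s : Store R) (r : R) (v : ℕ) : (s.set r v).out = s.out := rfl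

theorem set_eq_self (s : Store R) (r : R) (v : ℕ) (h : s.reg r = v) : s.set r v = s := by
  ext x <;> simp [reg_set]
  rintro rfl; exact h.symm

theorem set_at' (s : Store R) (w : List Γ') (p : ℕ) (r : R) (v : ℕ) :
    (s.at' w p).set r v = (s.set r v).at' w p := rfl

/-- No bound on `p` is needed: at the right end of the tape neither side changes any more. -/
theorem right_at' (s : Store R) (w : List Γ') (p : ℕ) :
    Act.right.apply (s.at' w p) = s.at' w (p + 1) := by
  ext x <;> simp [Act.apply]
  rw [List.take_add_one]
  simp
  cases w[p]? <;> simp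

end Store

variable {R : Type} [DecidableEq R]

/-- `Runs p s s' t`: the program `p` transforms `s` into `s'` in at most `t` steps. -/
def Runs (p : Prog R) (s s' : Store R) (t : ℕ) : Prop := ∃ u ≤ t, Exec p s s' u

namespace Runs

theorem mono {p : Prog R} {s s' : Store R} {t u : ℕ} (h : Runs p s s' t) (htu : t ≤ u) :
    Runs p s s' u := by
  obtain ⟨v, hv, h⟩ := h
  exact ⟨v, hv.trans htu, h⟩

theorem conv {p : Prog R} {s s' s'' : Store R} {t u : ℕ} (h : Runs p s s' t) (hs : s' = s'')
    (htu : t ≤ u) : Runs p s s'' u :=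
  hs ▸ h.mono htu

theorem act (a : Act R) (s : Store R) : Runs (.act a) s (a.apply s) 1 := ⟨1, le_rfl, .act a s⟩

theorem seq {p q : Prog R} {s₁ s₂ s₃ : Store R} {t₁ t₂ : ℕ} (h₁ : Runs p s₁ s₂ t₁)
    (h₂ : Runs q s₂ s₃ t₂) : Runs (.seq p q) s₁ s₃ (t₁ + t₂) := by
  obtain ⟨u₁, hu₁, h₁⟩ := h₁
  obtain ⟨u₂, hu₂, h₂⟩ := h₂
  exact ⟨u₁ + u₂, by omega, .seq h₁ h₂⟩

theorem ite {c : Test R} {p q : Prog R} {s s' : Store R} {t : ℕ}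
    (h₁ : c.eval s = true → Runs p s s' t) (h₂ : c.eval s = false → Runs q s s' t) :
    Runs (.ite c p q) s s' (1 + t) := by
  cases h : c.eval s with
  | true =>
    obtain ⟨u, hu, h'⟩ := h₁ h
    exact ⟨1 + u, by omega, .ite_true h h'⟩
  | false =>
    obtain ⟨u, hu, h'⟩ := h₂ h
    exact ⟨1 + u, by omega, .ite_false h h'⟩

/-- The function `f` gives the store before each round in closed form and so plays the role of a
loop invariant. The time is one test per round and one last failing test, besides the bodies. -/
theorem loop {c : Test R} {p : Prog R} {t : ℕ} (m : ℕ) (f : ℕ → Store R)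
    (h₁ : ∀ i < m, c.eval (f i) = true) (h₂ : c.eval (f m) = false)
    (h₃ : ∀ i < m, Runs p (f i) (f (i + 1)) t) :
    Runs (.loop c p) (f 0) (f m) (m * (t + 1) + 1) := by
  induction m generalizing f with
  | zero => exact ⟨1, by omega, .loop_false h₂⟩
  | succ m ih =>
    obtain ⟨u, hu, h'⟩ := ih (fun i => f (i + 1)) (fun i hi => h₁ _ (by omega)) h₂
      (fun i hi => h₃ _ (by omega))
    obtain ⟨v, hv, h''⟩ := h₃ 0 (by omega)
    exact ⟨1 + v + u, by nlinarith, .loop_true (h₁ 0 (by omega)) h'' h'⟩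

end Runs

/-- Do a list of actions. -/
def acts : List (Act R) → Prog R
  | [] => .act .nop
  | a :: l => .seq (.act a) (acts l)

theorem runs_acts (l : List (Act R)) (s : Store R) :
    Runs (acts l) s (l.foldl (fun s a => a.apply s) s) (l.length + 1) := by
  induction l generalizing s with
  | nil => exact Runs.act _ _
  | cons a l ih => exact ((Runs.act a s).seq (ih _)).mono (by simp; omega)

/-- Set a register to `0`. -/
def clear (r : R) : Prog R := .loop (.pos r) (.act (.dec r))

theorem runs_clear (r : R) (s : Store R) : Runs (clear r) s (s.set r 0) (2 * s.reg r + 1) := by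
  have h := Runs.loop (c := .pos r) (p := .act (.dec r)) (t := 1) (s.reg r)
    (fun i => s.set r (s.reg r - i)) (by intro i hi; simp [Test.eval]; omega)
    (by simp [Test.eval]) (by
      intro i hi
      refine (Runs.act _ _).conv ?_ le_rfl
      ext x <;> simp [Act.apply, Store.reg_set]
      split_ifs <;> omega)
  rw [show s.set r (s.reg r - 0) = s from s.set_eq_self r _ (by simp)] at h
  exact h.conv (by simp) (by omega)

/-- Add the register `x` to the register `y` and set `x` to `0`. -/
def move (x y : R) : Prog R := .loop (.pos x) (acts [.dec x, .inc y])

theorem runs_move {x y : R} (hxy : x ≠ y) (s : Store R) :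
    Runs (move x y) s ((s.set x 0).set y (s.reg y + s.reg x)) (4 * s.reg x + 1) := by
  have h := Runs.loop (c := .pos x) (p := acts [.dec x, .inc y]) (t := 3) (s.reg x)
    (fun i => (s.set x (s.reg x - i)).set y (s.reg y + i))
    (by intro i hi; simp [Test.eval, Store.reg_set, hxy]; omega)
    (by simp [Test.eval, Store.reg_set, hxy]) (by
      intro i hi
      refine (runs_acts _ _).conv ?_ le_rfl
      ext z <;> simp [Act.apply, Store.reg_set, hxy, hxy.symm]
      split_ifs <;> omega)
  have e0 : (s.set x (s.reg x - 0)).set y (s.reg y + 0) = s := by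
    ext z <;> simp [Store.reg_set]
    split_ifs <;> simp_all
  simp only [e0] at h
  exact h.conv (by simp) (by omega)

/-- Add the register `x` to the register `y`, using the empty register `t`. -/
def copy (x y t : R) : Prog R :=
  .seq (.loop (.pos x) (acts [.dec x, .inc y, .inc t])) (move t x)

theorem runs_copy {x y t : R} (hxy : x ≠ y) (hxt : x ≠ t) (hyt : y ≠ t) (s : Store R)
    (ht : s.reg t = 0) :
    Runs (copy x y t) s (s.set y (s.reg y + s.reg x)) (9 * s.reg x + 2) := by
  have h := Runs.loop (c := .pos x) (p := acts [.dec x, .inc y, .inc t]) (t := 4) (s.reg x)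
    (fun i => ((s.set x (s.reg x - i)).set y (s.reg y + i)).set t i)
    (by intro i hi; simp [Test.eval, Store.reg_set, hxy, hxt]; omega)
    (by simp [Test.eval, Store.reg_set, hxy, hxt]) (by
      intro i hi
      refine (runs_acts _ _).conv ?_ le_rfl
      ext z <;> simp [Act.apply, Store.reg_set, hxy, hxt, hxy.symm, hxt.symm, hyt, hyt.symm]
      split_ifs <;> simp_all <;> omega)
  have e0 : ((s.set x (s.reg x - 0)).set y (s.reg y + 0)).set t 0 = s := by
    ext z <;> simp [Store.reg_set]
    split_ifs <;> simp_all
  simp only [e0] at h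
  refine (h.seq (runs_move hxt.symm _)).conv ?_ ?_
  · ext z <;> simp [Store.reg_set, hxy, hxt]
    split_ifs <;> simp_all
  · simp; omega

/-- Move the head to the right by the value of the register `x`, using the empty register `t`. -/
def advance (x t : R) : Prog R :=
  .seq (.loop (.pos x) (acts [.dec x, .inc t, .right])) (move t x)

theorem runs_advance {x t : R} (hxt : x ≠ t) (s : Store R) (w : List Γ') (p : ℕ)
    (ht : s.reg t = 0) :
    Runs (advance x t) (s.at' w p) (s.at' w (p + s.reg x)) (9 * s.reg x + 2) := by
  have h := Runs.loop (c := .pos x) (p := acts [.dec x, .inc t, .right]) (t := 4) (s.reg x)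
    (fun i => ((s.set x (s.reg x - i)).set t i).at' w (p + i))
    (by intro i hi; simp [Test.eval, Store.reg_set, hxt]; omega)
    (by simp [Test.eval, Store.reg_set, hxt]) (by
      intro i hi
      refine (runs_acts _ _).conv ?_ le_rfl
      simp only [List.foldl_cons, List.foldl_nil, Act.apply.eq_6, Act.apply.eq_7, Store.set_at',
        Store.right_at']
      ext z <;> simp [Store.reg_set, hxt, hxt.symm, add_assoc]
      split_ifs <;> omega)
  have e0 : ((s.set x (s.reg x - 0)).set t 0).at' w (p + 0) = s.at' w p := by
    ext z <;> simp [Store.reg_set]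
    split_ifs <;> simp_all
  simp only [e0] at h
  refine (h.seq (runs_move hxt.symm _)).conv ?_ ?_
  · ext z <;> simp [Store.reg_set, hxt]
    split_ifs <;> simp_all
  · simp; omega

/-- Move the head to the left end of the tape. -/
def rewind : Prog R := .loop (.aux Option.isSome) (.act .left)

theorem runs_rewind (s : Store R) :
    Runs rewind s { s with inp := s.aux.reverse ++ s.inp, aux := [] } (2 * s.aux.length + 1) := by
  have h := Runs.loop (c := .aux Option.isSome) (p := .act .left) (t := 1) s.aux.length
    (fun i => { s with inp := (s.aux.take i).reverse ++ s.inp, aux := s.aux.drop i })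
    (by intro i hi; simpa [Test.eval] using hi)
    (by simp [Test.eval]) (by
      intro i hi
      refine (Runs.act _ _).conv ?_ le_rfl
      refine Store.ext' ?_ ?_ rfl fun _ => rfl
      · simp only [Act.apply]
        rw [List.take_add_one, List.reverse_append]
        simp [List.getElem?_eq_getElem hi]
      · simp [Act.apply])
  exact h.conv (by simp) (by omega)

theorem runs_rewind_at' (s : Store R) (w : List Γ') (p : ℕ) :
    Runs rewind (s.at' w p) (s.at' w 0) (2 * w.length + 1) := by
  refine (runs_rewind _).conv ?_ ?_
  · ext z <;> simp
  · simp

/-- Increase `z` if the register `x` is less than the register `y`, and set `x` and `y` to `0`. -/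
def compare (x y z : R) : Prog R :=
  .seq (.loop (.pos x) (acts [.dec x, .dec y]))
    (.ite (.pos y) (.seq (clear y) (.act (.inc z))) (.act .nop))

/-- Decrementing stops at zero, so once `x` has been subtracted from `y` in unit steps, `y` is
positive exactly when it was the larger one. -/
theorem runs_compare {x y z : R} (hxy : x ≠ y) (hxz : x ≠ z) (hyz : y ≠ z) (s : Store R) :
    Runs (compare x y z) s
      (((s.set x 0).set y 0).set z (s.reg z + if s.reg x < s.reg y then 1 else 0))
      (4 * s.reg x + 2 * s.reg y + 4) := by
  have h := Runs.loop (c := .pos x) (p := acts [.dec x, .dec y]) (t := 3) (s.reg x)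
    (fun i => (s.set x (s.reg x - i)).set y (s.reg y - i))
    (by intro i hi; simp [Test.eval, Store.reg_set, hxy]; omega)
    (by simp [Test.eval, Store.reg_set, hxy]) (by
      intro i hi
      refine (runs_acts _ _).conv ?_ le_rfl
      ext z <;> simp [Act.apply, Store.reg_set, hxy, hxy.symm]
      split_ifs <;> omega)
  have e0 : (s.set x (s.reg x - 0)).set y (s.reg y - 0) = s := by
    ext z <;> simp [Store.reg_set]
    split_ifs <;> simp_all
  simp only [e0] at h
  refine (h.seq (t₂ := 1 + (2 * s.reg y + 2)) (Runs.ite (fun hc => ?_) (fun hc => ?_))).mono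
    (by omega)
  · refine ((runs_clear _ _).seq (Runs.act _ _)).conv ?_ (by simp)
    have hc : s.reg x < s.reg y := by simpa [Test.eval] using hc
    ext u <;> simp [Act.apply, Store.reg_set, hc, hxz.symm, hyz.symm]
    split_ifs <;> simp_all
  · refine (Runs.act _ _).conv ?_ (by omega)
    have hc : ¬ s.reg x < s.reg y := by
      have : s.reg y ≤ s.reg x := by simpa [Test.eval] using hc
      omega
    ext u <;> simp [Act.apply, Store.reg_set, hc]
    split_ifs <;> simp_all


/-! ### First-order formulas with a threshold quantifier, and the layout of the input word -/

/-- First-order formulas about an instance, with free variables in `ι` that range over the vertices.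
`few φ` says that at most `k` vertices satisfy `φ`. -/
inductive Formula : Type → Type 1
  | memT {ι : Type} (i : ι) : Formula ι
  | adj {ι : Type} (i j : ι) : Formula ι
  | lt {ι : Type} (i j : ι) : Formula ι
  | not {ι : Type} (φ : Formula ι) : Formula ι
  | and {ι : Type} (φ ψ : Formula ι) : Formula ι
  | ex {ι : Type} (φ : Formula (Option ι)) : Formula ι
  | few {ι : Type} (φ : Formula (Option ι)) : Formula ι

namespace Formula

/-- The truth of a formula in an instance. -/
def Holds (I : SFVSInstance) : {ι : Type} → Formula ι → (ι → Fin I.n) → Prop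
  | _, memT i, e => e i ∈ I.T
  | _, adj i j, e => I.G.Adj (e i) (e j)
  | _, lt i j, e => e i < e j
  | _, not φ, e => ¬ φ.Holds I e
  | _, and φ ψ, e => φ.Holds I e ∧ ψ.Holds I e
  | _, ex φ, e => ∃ a, φ.Holds I fun o => o.elim a e
  | _, few φ, e => {a | φ.Holds I fun o => o.elim a e}.ncard ≤ I.k

/-- The quantifier depth of a formula. -/
def depth : {ι : Type} → Formula ι → ℕ
  | _, memT _ => 0
  | _, adj _ _ => 0
  | _, lt _ _ => 0
  | _, not φ => φ.depth
  | _, and φ ψ => max φ.depth ψ.depth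
  | _, ex φ => φ.depth + 1
  | _, few φ => φ.depth + 1

end Formula

section Encoding

theorem encodeWords_cons (w : List Bool) (ws : List (List Bool)) :
    encodeWords (w :: ws) = w.map Γ'.bit ++ Γ'.comma :: encodeWords ws := by
  simp [encodeWords]

/-- With its comma, each earlier word occupies `n + 1` symbols. Only the words before the `i`-th
need length `n`, so the binary digits of `k` at the end do no harm. -/
theorem getElem?_encodeWords {n : ℕ} : ∀ {ws : List (List Bool)} {i j : ℕ} {u : List Bool},
    ws[i]? = some u → j < u.length → (∀ v ∈ ws.take i, v.length = n) →
      (encodeWords ws)[i * (n + 1) + j]? = u[j]?.map Γ'.bit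
  | [], i, j, u, h, _, _ => by simp at h
  | w :: ws, 0, j, u, h, hj, _ => by
    obtain rfl : w = u := by simpa using h
    rw [encodeWords_cons, List.getElem?_append_left (by simpa using hj)]
    simp
  | w :: ws, i + 1, j, u, h, hj, hl => by
    have hw : w.length = n := hl w (by simp)
    have ih := getElem?_encodeWords (n := n) (ws := ws) (i := i) (by simpa using h) hj
      (fun v hv => hl v (by simp [hv]))
    rw [encodeWords_cons, List.getElem?_append_right (by simp [hw]; nlinarith), ← ih]
    rw [show (i + 1) * (n + 1) + j - (w.map Γ'.bit).length = (i * (n + 1) + j) + 1 by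
      simp only [List.length_map, hw]
      rw [Nat.sub_eq_iff_eq_add (by nlinarith)]; ring]
    simp

end Encoding

variable (I : SFVSInstance)

theorem getElem?_encode_memT (i : Fin I.n) [Decidable (i ∈ I.T)] :
    I.encode[(i : ℕ)]? = some (Γ'.bit (decide (i ∈ I.T))) := by
  have := getElem?_encodeWords (n := I.n) (ws := I.words) (i := 0) (j := i) rfl (by simp) (by simp)
  rw [SFVSInstance.encode]
  simpa using this

/-- The characteristic vector of `T` is word number `0`, which shifts row `i` of the matrix to word
`i + 1`. -/
theorem getElem?_encode_adj (i j : Fin I.n) [Decidable (I.G.Adj i j)] :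
    I.encode[((i : ℕ) + 1) * (I.n + 1) + j]? = some (Γ'.bit (decide (I.G.Adj i j))) := by
  classical
  have := getElem?_encodeWords (n := I.n) (ws := I.words) (i := i + 1) (j := j)
    (u := (List.finRange I.n).map fun j => decide (I.G.Adj i j))
    (by simp [SFVSInstance.words]) (by simp) (by
      intro v hv
      simp only [SFVSInstance.words, List.cons_append, List.take_succ_cons, List.mem_cons] at hv
      rcases hv with rfl | hv
      · simp
      · rw [List.take_append_of_le_length (by simp)] at hv
        have := List.mem_of_mem_take hv
        simp only [List.mem_map] at this
        obtain ⟨_, _, rfl⟩ := this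
        simp)
  rw [SFVSInstance.encode, this]
  simp

theorem n_le_length_encode : I.n ≤ I.encode.length := by
  simp [SFVSInstance.encode, SFVSInstance.words, encodeWords_cons]

/-! ### Evaluation of formulas by counter programs -/

/-- The registers of the programs that evaluate formulas of quantifier depth at most `D`. -/
inductive Reg (D : ℕ)
  | size
  | bound
  | res
  | t₁
  | t₂
  | t₃
  | var (i : Fin (D + 1))
  | cnt (i : Fin (D + 1))
  | acc (i : Fin (D + 1))
  deriving DecidableEq, Fintype

variable {D : ℕ}

/-- Whether a symbol is the bit `1`. -/
def isTrue (o : Option Γ') : Bool := decide (o = some (.bit true))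

/-- Move the head to the right by one row of the adjacency matrix. -/
def skipRow : Prog (Reg D) := .seq (advance .size .t₁) (.act .right)

/-- Increase `res` if the head reads the bit `1`, and rewind. -/
def query : Prog (Reg D) :=
  .seq (.ite (.inp isTrue) (.act (.inc .res)) (.act .nop)) rewind

/-- Evaluate the formula `x ∈ T`. -/
def evalMemT (x : Reg D) : Prog (Reg D) := .seq (advance x .t₁) query

/-- Evaluate the formula `Adj x y`. -/
def evalAdj (x y : Reg D) : Prog (Reg D) :=
  .seq skipRow <| .seq (.loop (.pos x) (.seq (acts [.dec x, .inc .t₂]) skipRow)) <|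
    .seq (move .t₂ x) <| .seq (advance y .t₁) query

/-- Evaluate the formula `x < y`. -/
def evalLt (x y : Reg D) : Prog (Reg D) :=
  .seq (copy x .t₂ .t₁) <| .seq (copy y .t₃ .t₁) (compare .t₂ .t₃ .res)

/-- Negate the truth value in `res`. -/
def negate : Prog (Reg D) := .ite (.pos .res) (.act (.dec .res)) (.act (.inc .res))

/-- Count in `acc i` the values of `var i` below `size` for which `p` finds the result `1`. -/
def countLoop (i : Fin (D + 1)) (p : Prog (Reg D)) : Prog (Reg D) :=
  .seq (copy .size (.cnt i) .t₁) <|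
    .seq (.loop (.pos (.cnt i)) <| .seq (.act (.dec (.cnt i))) <| .seq p <|
      .seq (.ite (.pos .res) (acts [.dec .res, .inc (.acc i)]) (.act .nop))
        (.act (.inc (.var i)))) (clear (.var i))

/-- Decide whether the register `acc i` is at most `bound`, and set it to `0`. -/
def atMost (i : Fin (D + 1)) : Prog (Reg D) :=
  .seq (move (.acc i) .t₃) <| .seq (copy .bound .t₂ .t₁) <| .seq (compare .t₂ .t₃ .res) negate

/-- Decide whether the register `acc i` is positive, and set it to `0`. -/
def isPos (i : Fin (D + 1)) : Prog (Reg D) :=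
  .ite (.pos (.acc i)) (.seq (clear (.acc i)) (.act (.inc .res))) (.act .nop)

/-- Evaluate a formula whose variables are held in registers below the level `m`. -/
def Formula.prog (D : ℕ) : {ι : Type} → Formula ι → (ι → ℕ) → ℕ → Prog (Reg D)
  | _, memT i, ρ, _ => evalMemT (.var (Fin.ofNat _ (ρ i)))
  | _, adj i j, ρ, _ => evalAdj (.var (Fin.ofNat _ (ρ i))) (.var (Fin.ofNat _ (ρ j)))
  | _, lt i j, ρ, _ => evalLt (.var (Fin.ofNat _ (ρ i))) (.var (Fin.ofNat _ (ρ j)))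
  | _, not φ, ρ, m => .seq (φ.prog D ρ m) negate
  | _, and φ ψ, ρ, m => .seq (φ.prog D ρ m) <|
      .ite (.pos .res) (.seq (.act (.dec .res)) (ψ.prog D ρ m)) (.act .nop)
  | _, ex φ, ρ, m => .seq (countLoop (Fin.ofNat _ m) (φ.prog D (fun o => o.elim m ρ) (m + 1))) <|
      isPos (Fin.ofNat _ m)
  | _, few φ, ρ, m => .seq (countLoop (Fin.ofNat _ m) (φ.prog D (fun o => o.elim m ρ) (m + 1))) <|
      atMost (Fin.ofNat _ m)

/-- The store is prepared for the evaluation of a formula at the level `m`. -/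
structure Ready (m : ℕ) (s : Store (Reg D)) : Prop where
  inp : s.inp = I.encode
  aux : s.aux = []
  size : s.reg .size = I.n
  bound : s.reg .bound = min I.k I.n
  res : s.reg .res = 0
  t₁ : s.reg .t₁ = 0
  t₂ : s.reg .t₂ = 0
  t₃ : s.reg .t₃ = 0
  var : ∀ i : Fin (D + 1), m ≤ i → s.reg (.var i) = 0
  cnt : ∀ i : Fin (D + 1), m ≤ i → s.reg (.cnt i) = 0
  acc : ∀ i : Fin (D + 1), m ≤ i → s.reg (.acc i) = 0

theorem runs_skipRow (s : Store (Reg D)) (w : List Γ') (p : ℕ) (h : s.reg .t₁ = 0) :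
    Runs skipRow (s.at' w p) (s.at' w (p + (s.reg .size + 1))) (9 * s.reg .size + 3) :=
  ((runs_advance (by simp) s w p h).seq (Runs.act _ _)).conv (Store.right_at' _ _ _) (by omega)

theorem runs_query (s : Store (Reg D)) (w : List Γ') (p : ℕ) (b : Bool) (h : s.reg .res = 0)
    (hw : w[p]? = some (.bit b)) :
    Runs query (s.at' w p) ((s.set .res (if b then 1 else 0)).at' w 0) (2 * w.length + 3) := by
  have h1 : Runs (.ite (.inp isTrue) (.act (.inc .res)) (.act .nop)) (s.at' w p)
      ((s.set .res (if b then 1 else 0)).at' w p) (1 + 1) := by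
    refine Runs.ite (fun hc => (Runs.act _ _).conv ?_ le_rfl)
      (fun hc => (Runs.act _ _).conv ?_ le_rfl)
    · have : b = true := by simpa [Test.eval, isTrue, hw] using hc
      subst this
      simp [Act.apply, h, Store.set_at']
    · have : b = false := by simpa [Test.eval, isTrue, hw] using hc
      subst this
      simp [Act.apply, Store.set_eq_self _ _ _ h]
  exact (h1.seq (runs_rewind_at' _ _ _)).mono (by omega)

theorem runs_negate (s : Store (Reg D)) (Q : Prop) [Decidable Q]
    (h : s.reg .res = if Q then 1 else 0) :
    Runs negate s (s.set .res (if ¬ Q then 1 else 0)) 2 := by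
  refine Runs.ite (t := 1) (fun hc => (Runs.act _ _).conv ?_ le_rfl)
    (fun hc => (Runs.act _ _).conv ?_ le_rfl)
  all_goals
    by_cases hQ : Q <;> simp [Test.eval, h, hQ] at hc
    simp [Act.apply, h, hQ]

variable {I}

theorem runs_evalMemT {m : ℕ} {s : Store (Reg D)} (h : Ready I m s) (i : Fin (D + 1)) (a : Fin I.n)
    (ha : s.reg (.var i) = a) [Decidable (a ∈ I.T)] :
    Runs (evalMemT (.var i)) s (s.set .res (if a ∈ I.T then 1 else 0))
      (11 * I.encode.length + 5) := by
  have hn := n_le_length_encode I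
  have h1 := (runs_advance (x := .var i) (by simp) s I.encode 0 h.t₁).seq
    (runs_query s I.encode _ (decide (a ∈ I.T)) h.res (by
      rw [ha, zero_add]; exact getElem?_encode_memT I a))
  rw [Store.at'_zero s _ h.inp h.aux, Store.at'_zero _ _ (by simp [h.inp]) (by simp [h.aux])] at h1
  exact h1.conv (by simp) (by have := a.2; omega)

/-- The first `skipRow` passes the characteristic vector and `a` further ones pass the rows before
row `a`. The loop consumes the variable `i`, whose value is kept in `t₂` and moved back. Up to `n`
skips of linear cost give the quadratic bound. -/
theorem runs_evalAdj {m : ℕ} {s : Store (Reg D)} (h : Ready I m s) (i j : Fin (D + 1))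
    (a b : Fin I.n) (ha : s.reg (.var i) = a) (hb : s.reg (.var j) = b)
    [Decidable (I.G.Adj a b)] :
    Runs (evalAdj (.var i) (.var j)) s (s.set .res (if I.G.Adj a b then 1 else 0))
      (9 * I.encode.length * I.encode.length + 40 * I.encode.length + 20) := by
  have hn := n_le_length_encode I
  have hsize := h.size
  have ht₂ := h.t₂
  have h1 : Runs skipRow s (s.at' I.encode (I.n + 1)) (9 * I.n + 3) := by
    have := runs_skipRow s I.encode 0 h.t₁
    rwa [Store.at'_zero s _ h.inp h.aux, hsize, zero_add] at this
  have h2 := Runs.loop (c := .pos (.var i)) (p := .seq (acts [.dec (.var i), .inc .t₂]) skipRow)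
    (t := 3 + (9 * I.n + 3)) (a : ℕ)
    (fun c => ((s.set (.var i) (a - c)).set .t₂ c).at' I.encode ((c + 1) * (I.n + 1)))
    (by intro c hc; simp [Test.eval, Store.reg_set]; omega)
    (by simp [Test.eval, Store.reg_set]) (by
      intro c hc
      refine Runs.seq (s₂ := ((s.set (.var i) (a - (c + 1))).set .t₂ (c + 1)).at' I.encode
        ((c + 1) * (I.n + 1))) ((runs_acts _ _).conv ?_ le_rfl)
        ((runs_skipRow _ _ _ (by simp [Store.reg_set, h.t₁])).conv ?_ ?_)
      · ext x <;> simp [Act.apply, Store.reg_set]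
        split_ifs <;> simp_all <;> omega
      · simp only [Store.reg_set, reduceCtorEq, if_false, hsize]
        congr 1; ring
      · simp [Store.reg_set, hsize])
  have e0 : ((s.set (.var i) (a - 0)).set .t₂ 0).at' I.encode ((0 + 1) * (I.n + 1)) =
      s.at' I.encode (I.n + 1) := by
    ext x <;> simp [Store.reg_set]
    split_ifs <;> simp_all
  simp only [e0] at h2
  have h3 : Runs (move .t₂ (.var i))
      (((s.set (.var i) (a - a)).set .t₂ a).at' I.encode ((a + 1) * (I.n + 1)))
      (s.at' I.encode ((a + 1) * (I.n + 1))) (4 * a + 1) := by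
    refine (runs_move (by simp) _).conv ?_ (by simp)
    ext x <;> simp [Store.reg_set]
    split_ifs <;> simp_all
  have h4 := runs_advance (x := .var j) (by simp) s I.encode ((a + 1) * (I.n + 1)) h.t₁
  have h5 := runs_query s I.encode ((a + 1) * (I.n + 1) + s.reg (.var j)) (decide (I.G.Adj a b))
    h.res (by rw [hb]; exact getElem?_encode_adj I a b)
  refine (h1.seq (h2.seq (h3.seq (h4.seq h5)))).conv ?_ ?_
  · rw [Store.at'_zero _ _ (by simp [h.inp]) (by simp [h.aux])]
    simp
  · have := a.2
    have := b.2
    rw [hb]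
    have : (a : ℕ) * (3 + (9 * I.n + 3) + 1) ≤
        I.encode.length * (3 + (9 * I.encode.length + 3) + 1) :=
      Nat.mul_le_mul (by omega) (by omega)
    nlinarith

theorem runs_evalLt {m : ℕ} {s : Store (Reg D)} (h : Ready I m s) (i j : Fin (D + 1))
    (a b : Fin I.n) (ha : s.reg (.var i) = a) (hb : s.reg (.var j) = b) :
    Runs (evalLt (.var i) (.var j)) s (s.set .res (if a < b then 1 else 0))
      (24 * I.encode.length + 8) := by
  have hn := n_le_length_encode I
  have ht₁ := h.t₁
  have ht₂ := h.t₂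
  have ht₃ := h.t₃
  have hres := h.res
  have h1 := runs_copy (x := .var i) (y := .t₂) (t := .t₁) (by simp) (by simp) (by simp) s h.t₁
  have h2 := runs_copy (x := .var j) (y := .t₃) (t := .t₁) (by simp) (by simp) (by simp)
    (s.set .t₂ (s.reg .t₂ + s.reg (.var i))) (by simpa [Store.reg_set] using h.t₁)
  have h3 := runs_compare (x := .t₂) (y := .t₃) (z := .res) (by simp) (by simp) (by simp)
    ((s.set .t₂ (s.reg .t₂ + s.reg (.var i))).set .t₃
      ((s.set .t₂ (s.reg .t₂ + s.reg (.var i))).reg .t₃ +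
        (s.set .t₂ (s.reg .t₂ + s.reg (.var i))).reg (.var j)))
  refine (h1.seq (h2.seq h3)).conv ?_ ?_
  · ext x <;> simp [Store.reg_set]
    split_ifs <;> simp_all
  · have := a.2
    have := b.2
    simp [Store.reg_set, ha, hb, ht₂, ht₃]
    omega

/-- Before round `c` the variable is `c`, the counter is `n - c`, and the accumulator holds the
number of successes below `c`. The body is assumed correct for all contents of counter and
accumulator, as these change from round to round. -/
theorem runs_countLoop (i : Fin (D + 1)) (p : Prog (Reg D)) (s : Store (Reg D)) (P : ℕ → Prop)
    [DecidablePred P] (n t : ℕ) (hn : s.reg .size = n) (ht₁ : s.reg .t₁ = 0)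
    (hres : s.reg .res = 0) (hc : s.reg (.cnt i) = 0) (hv : s.reg (.var i) = 0)
    (ha : s.reg (.acc i) = 0)
    (h : ∀ a < n, ∀ u v, Runs p (((s.set (.cnt i) u).set (.acc i) v).set (.var i) a)
      ((((s.set (.cnt i) u).set (.acc i) v).set (.var i) a).set .res (if P a then 1 else 0)) t) :
    Runs (countLoop i p) s (s.set (.acc i) (Nat.count P n)) (n * (t + 20) + 4) := by
  have h1 := runs_copy (x := .size) (y := .cnt i) (t := .t₁) (by simp) (by simp) (by simp) s ht₁
  have h2 := Runs.loop (c := .pos (.cnt i)) (p := .seq (.act (.dec (.cnt i))) <| .seq p <|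
      .seq (.ite (.pos .res) (acts [.dec .res, .inc (.acc i)]) (.act .nop))
        (.act (.inc (.var i)))) (t := 1 + (t + (4 + 1))) n
    (fun c => ((s.set (.cnt i) (n - c)).set (.acc i) (Nat.count P c)).set (.var i) c)
    (by intro c hc; simp [Test.eval, Store.reg_set]; omega)
    (by simp [Test.eval, Store.reg_set]) (by
      intro c hcn
      refine Runs.seq (s₂ := ((s.set (.cnt i) (n - (c + 1))).set (.acc i)
        (Nat.count P c)).set (.var i) c) ((Runs.act _ _).conv ?_ le_rfl)
        ((h c hcn _ _).seq (Runs.seq (s₂ := ((s.set (.cnt i) (n - (c + 1))).set (.acc i)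
          (Nat.count P (c + 1))).set (.var i) c)
        ((Runs.ite (t := 3) (fun hc => (runs_acts _ _).conv ?_ le_rfl)
          (fun hc => (Runs.act _ _).conv ?_ (by omega))).mono (by omega))
        ((Runs.act _ _).conv ?_ le_rfl)))
      · ext x <;> simp [Act.apply, Store.reg_set]
        split_ifs <;> simp_all <;> omega
      · have hP : P c := by
          by_contra hP
          simp [Test.eval, hP] at hc
        ext x <;> simp [Act.apply, Store.reg_set, Nat.count_succ, hP]
        split_ifs <;> simp_all
      · have hP : ¬ P c := by
          intro hP
          simp [Test.eval, hP] at hc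
        ext x <;> simp [Act.apply, Store.reg_set, Nat.count_succ, hP]
        split_ifs <;> simp_all
      · ext x <;> simp [Act.apply, Store.reg_set]
        split_ifs <;> simp_all)
  have e0 : ((s.set (.cnt i) (n - 0)).set (.acc i) (Nat.count P 0)).set (.var i) 0 =
      s.set (.cnt i) (s.reg (.cnt i) + s.reg .size) := by
    ext x <;> simp [Store.reg_set]
    split_ifs <;> simp_all
  simp only [e0] at h2
  refine (h1.seq (h2.seq (runs_clear (.var i) _))).conv ?_ ?_
  · ext x <;> simp [Store.reg_set]
    split_ifs <;> simp_all
  · simp [hn]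
    nlinarith

theorem runs_atMost (i : Fin (D + 1)) (s : Store (Reg D)) (c : ℕ) (ha : s.reg (.acc i) = 0)
    (ht₁ : s.reg .t₁ = 0) (ht₂ : s.reg .t₂ = 0) (ht₃ : s.reg .t₃ = 0) (hres : s.reg .res = 0) :
    Runs (atMost i) (s.set (.acc i) c) (s.set .res (if c ≤ s.reg .bound then 1 else 0))
      (6 * c + 13 * s.reg .bound + 9) := by
  have h2 : Runs (move (.acc i) .t₃) (s.set (.acc i) c) (s.set .t₃ c) (4 * c + 1) := by
    refine (runs_move (by simp) _).conv ?_ (by simp)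
    ext x <;> simp [Store.reg_set]
    split_ifs <;> simp_all
  have h3 : Runs (copy .bound .t₂ .t₁) (s.set .t₃ c) ((s.set .t₃ c).set .t₂ (s.reg .bound))
      (9 * s.reg .bound + 2) := by
    refine (runs_copy (by simp) (by simp) (by simp) _ ?_).conv ?_ ?_ <;>
      simp [Store.reg_set, ht₁, ht₂]
  have h4 : Runs (compare .t₂ .t₃ .res) ((s.set .t₃ c).set .t₂ (s.reg .bound))
      (s.set .res (if s.reg .bound < c then 1 else 0)) (4 * s.reg .bound + 2 * c + 4) := by
    refine (runs_compare (by simp) (by simp) (by simp) _).conv ?_ (by simp [Store.reg_set])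
    ext x <;> simp [Store.reg_set]
    split_ifs <;> simp_all
  refine (h2.seq (h3.seq (h4.seq (runs_negate _ (s.reg .bound < c) (by simp))))).conv ?_ (by omega)
  simp only [not_lt]
  ext x <;> simp [Store.reg_set]
  split_ifs <;> simp_all

theorem runs_isPos (i : Fin (D + 1)) (s : Store (Reg D)) (c : ℕ) (ha : s.reg (.acc i) = 0)
    (hres : s.reg .res = 0) :
    Runs (isPos i) (s.set (.acc i) c) (s.set .res (if 0 < c then 1 else 0)) (2 * c + 3) := by
  refine (Runs.ite (t := 2 * c + 2) (fun hc => ?_) (fun hc => ?_)).mono (by omega)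
  · have hx : 0 < c := by simpa [Test.eval] using hc
    refine ((runs_clear _ _).seq (Runs.act _ _)).conv ?_ (by simp)
    rw [if_pos hx]
    ext x <;> simp [Act.apply, Store.reg_set]
    split_ifs <;> simp_all
  · have hx : c = 0 := by simpa [Test.eval] using hc
    subst hx
    refine (Runs.act _ _).conv ?_ (by omega)
    ext x <;> simp [Act.apply, Store.reg_set]
    split_ifs <;> simp_all

/-- The loop of level `m` owns only the registers with index `m`, and deeper levels require only
those of larger index to be empty. -/
theorem Ready.next {m : ℕ} (hm : m ≤ D) {s : Store (Reg D)} (h : Ready I m s) (u v a : ℕ) :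
    Ready I (m + 1) (((s.set (.cnt (Fin.ofNat _ m)) u).set (.acc (Fin.ofNat _ m)) v).set
      (.var (Fin.ofNat _ m)) a) := by
  -- Because `m ≤ D`, the reduction modulo `D + 1` in `Fin.ofNat` has no effect.
  have key : ∀ i : Fin (D + 1), m + 1 ≤ i → i ≠ Fin.ofNat _ m := by
    rintro i hi rfl
    simp [Nat.mod_eq_of_lt (Nat.lt_succ_of_le hm)] at hi
  obtain ⟨h1, h2, h3, h4, h5, h6, h7, h8, h9, h10, h11⟩ := h
  constructor <;> simp only [Store.inp_set, Store.aux_set, Store.reg_set, reduceCtorEq, if_false,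
    Reg.var.injEq, Reg.cnt.injEq, Reg.acc.injEq] <;> try assumption
  all_goals
    intro i hi
    rw [if_neg (key i hi)]
    first | exact h9 i (by omega) | exact h10 i (by omega) | exact h11 i (by omega)

theorem count_eq_ncard {n : ℕ} (P : Fin n → Prop) [DecidablePred fun a => ∃ h : a < n, P ⟨a, h⟩] :
    Nat.count (fun a => ∃ h : a < n, P ⟨a, h⟩) n = {a | P a}.ncard := by
  classical
  rw [Nat.count_eq_card_filter_range, Set.ncard_eq_toFinset_card']
  symm
  refine Finset.card_bij (fun a _ => a) ?_ ?_ ?_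
  · intro a ha
    simpa using ha
  · intro a _ b _ h
    exact Fin.ext h
  · intro b hb
    simp only [Finset.mem_filter, Finset.mem_range] at hb
    exact ⟨⟨b, hb.1⟩, by simpa using hb.2.2, rfl⟩

-- The quantified variable lives in register `m`, while `ρ i < m` keeps the variables already bound
-- in other registers; hence the loop does not overwrite them.
open Classical in
theorem runs_countFormula {ι : Type} (φ : Formula (Option ι)) (t : ℕ) {D m : ℕ} (hm : m ≤ D)
    (ρ : ι → ℕ) (hρ : ∀ i, ρ i < m) {s : Store (Reg D)} (e : ι → Fin I.n) (h : Ready I m s)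
    (he : ∀ i, s.reg (.var (Fin.ofNat _ (ρ i))) = e i)
    (hP : ∀ (s : Store (Reg D)) (e : Option ι → Fin I.n), Ready I (m + 1) s →
      (∀ i, s.reg (.var (Fin.ofNat _ (i.elim m ρ))) = e i) →
      Runs (φ.prog D (fun o => o.elim m ρ) (m + 1)) s
        (s.set .res (if φ.Holds I e then 1 else 0)) t) :
    Runs (countLoop (Fin.ofNat _ m) (φ.prog D (fun o => o.elim m ρ) (m + 1))) s
      (s.set (.acc (Fin.ofNat _ m)) {a | φ.Holds I fun o => o.elim a e}.ncard)
      (I.n * (t + 20) + 4) := by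
  have hv : m ≤ (Fin.ofNat (D + 1) m : ℕ) := by simp [Nat.mod_eq_of_lt (Nat.lt_succ_of_le hm)]
  have key := runs_countLoop (Fin.ofNat _ m) (φ.prog D (fun o => o.elim m ρ) (m + 1)) s
    (fun a => ∃ h : a < I.n, φ.Holds I fun o => o.elim ⟨a, h⟩ e) I.n t h.size h.t₁ h.res
    (h.cnt _ hv) (h.var _ hv) (h.acc _ hv) (by
      intro a ha u v
      refine (hP _ (fun o => o.elim ⟨a, ha⟩ e) (h.next hm u v a) ?_).conv ?_ le_rfl
      · rintro (_ | i)
        · simp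
        · have : (Fin.ofNat (D + 1) (ρ i)) ≠ Fin.ofNat _ m := by
            intro hc
            have := congrArg Fin.val hc
            simp only [Fin.val_ofNat] at this
            rw [Nat.mod_eq_of_lt (by have := hρ i; omega), Nat.mod_eq_of_lt (by omega)] at this
            exact (hρ i).ne this
          simp only [Store.reg_set, Reg.var.injEq, reduceCtorEq, if_false, Option.elim_some, this]
          exact he i
      · congr 1
        simp [ha])
  rwa [count_eq_ncard fun a => φ.Holds I fun o => o.elim a e] at key

-- The polynomial is chosen before the level, the registers and the instance, so it depends on the
-- formula alone. Connectives add times, and a quantifier multiplies by `n`, which is at most the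
-- input length.
open Classical in
theorem runs_formula {ι : Type} (φ : Formula ι) : ∃ P : Polynomial ℕ,
    ∀ (D m : ℕ) (ρ : ι → ℕ), m + φ.depth ≤ D → (∀ i, ρ i < m) →
    ∀ (I : SFVSInstance) (s : Store (Reg D)) (e : ι → Fin I.n), Ready I m s →
      (∀ i, s.reg (.var (Fin.ofNat _ (ρ i))) = e i) →
      Runs (φ.prog D ρ m) s (s.set .res (if φ.Holds I e then 1 else 0))
        (P.eval I.encode.length) := by
  induction φ with
  | memT i =>
    refine ⟨11 * .X + 5, fun D m ρ _ _ I s e h he => ?_⟩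
    exact (runs_evalMemT h _ (e i) (he i)).conv
      (by simp only [Formula.Holds]; congr) (by simp)
  | adj i j =>
    refine ⟨9 * .X * .X + 40 * .X + 20, fun D m ρ _ _ I s e h he => ?_⟩
    exact (runs_evalAdj h _ _ (e i) (e j) (he i) (he j)).conv
      (by simp only [Formula.Holds]; congr) (by simp)
  | lt i j =>
    refine ⟨24 * .X + 8, fun D m ρ _ _ I s e h he => ?_⟩
    exact (runs_evalLt h _ _ (e i) (e j) (he i) (he j)).conv
      (by simp only [Formula.Holds]; congr) (by simp)
  | not φ ih =>
    obtain ⟨P, hP⟩ := ih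
    refine ⟨P + 2, fun D m ρ hD hρ I s e h he => ?_⟩
    refine ((hP D m ρ hD hρ I s e h he).seq (runs_negate _ (φ.Holds I e) (by simp))).conv ?_
      (by simp)
    ext x <;> simp [Store.reg_set, Formula.Holds]
    split_ifs <;> simp_all
  | and φ ψ ihφ ihψ =>
    obtain ⟨P, hP⟩ := ihφ
    obtain ⟨Q, hQ⟩ := ihψ
    refine ⟨P + Q + 2, fun D m ρ hD hρ I s e h he => ?_⟩
    simp only [Formula.depth] at hD
    have h1 := hP D m ρ (by omega) hρ I s e h he
    have h2 := hQ D m ρ (by omega) hρ I s e h he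
    refine (h1.seq (Runs.ite (s' := s.set .res (if (φ.and ψ).Holds I e then 1 else 0))
      (t := 1 + Q.eval I.encode.length) (fun hc => ?_) (fun hc => ?_))).mono (by simp; omega)
    · have hφ : φ.Holds I e := by
        by_contra hP
        simp [Test.eval, hP] at hc
      -- Resetting `res` restores `s` itself, so the second conjunct starts from a store that is
      -- again ready.
      refine Runs.seq (s₂ := s) ((Runs.act _ _).conv ?_ le_rfl) (h2.conv ?_ le_rfl)
      · ext x <;> simp [Act.apply, Store.reg_set, hφ]
        split_ifs with hx
        · rw [hx, h.res]
        · rfl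
      · simp [Formula.Holds, hφ]
    · have hφ : ¬ φ.Holds I e := by
        intro hP
        simp [Test.eval, hP] at hc
      exact (Runs.act _ _).conv (by simp [Act.apply, Formula.Holds, hφ]) (by omega)
  | ex φ ih =>
    obtain ⟨P, hP⟩ := ih
    refine ⟨.X * (P + 20) + 2 * .X + 10, fun D m ρ hD hρ I s e h he => ?_⟩
    simp only [Formula.depth] at hD
    have hn := n_le_length_encode I
    have hρ' : ∀ o : Option _, o.elim m ρ < m + 1 := by
      rintro (_ | i)
      · exact Nat.lt_succ_self _
      · exact (hρ i).trans (Nat.lt_succ_self _)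
    have h1 := runs_countFormula φ _ (by omega) ρ hρ e h he
      (hP D (m + 1) _ (by omega) hρ' I)
    have hv : m ≤ (Fin.ofNat (D + 1) m : ℕ) := by
      simp [Nat.mod_eq_of_lt (show m < D + 1 by omega)]
    have hle : {a | φ.Holds I fun o => o.elim a e}.ncard ≤ I.n := by
      simpa using Set.ncard_le_card {a | φ.Holds I fun o => o.elim a e}
    have hex : (Formula.ex φ).Holds I e ↔ 0 < {a | φ.Holds I fun o => o.elim a e}.ncard := by
      rw [Set.ncard_pos]; rfl
    refine (h1.seq (runs_isPos _ _ _ (h.acc _ hv) h.res)).conv ?_ ?_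
    · simp only [hex]
    · simp only [Polynomial.eval_add, Polynomial.eval_mul, Polynomial.eval_X,
        Polynomial.eval_ofNat]
      have := Nat.mul_le_mul_right (P.eval I.encode.length + 20) hn
      omega
  | few φ ih =>
    obtain ⟨P, hP⟩ := ih
    refine ⟨.X * (P + 20) + 30 * .X + 30, fun D m ρ hD hρ I s e h he => ?_⟩
    simp only [Formula.depth] at hD
    have hn := n_le_length_encode I
    have hρ' : ∀ o : Option _, o.elim m ρ < m + 1 := by
      rintro (_ | i)
      · exact Nat.lt_succ_self _
      · exact (hρ i).trans (Nat.lt_succ_self _)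
    have h1 := runs_countFormula φ _ (by omega) ρ hρ e h he
      (hP D (m + 1) _ (by omega) hρ' I)
    have hv : m ≤ (Fin.ofNat (D + 1) m : ℕ) := by
      simp [Nat.mod_eq_of_lt (show m < D + 1 by omega)]
    have hle : {a | φ.Holds I fun o => o.elim a e}.ncard ≤ I.n := by
      simpa using Set.ncard_le_card {a | φ.Holds I fun o => o.elim a e}
    -- A set of vertices has at most `n` elements, so comparing its size with `min k n` is the same
    -- as comparing it with `k`.
    have hfew : (Formula.few φ).Holds I e ↔
        {a | φ.Holds I fun o => o.elim a e}.ncard ≤ s.reg .bound := by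
      simp only [Formula.Holds, h.bound]; omega
    refine (h1.seq (runs_atMost _ _ _ (h.acc _ hv) h.t₁ h.t₂ h.t₃ h.res)).conv ?_ ?_
    · simp only [hfew]
    · simp only [Polynomial.eval_add, Polynomial.eval_mul, Polynomial.eval_X,
        Polynomial.eval_ofNat]
      have := Nat.mul_le_mul_right (P.eval I.encode.length + 20) hn
      have := h.bound
      omega


/-! ### Reading the input and writing the answer -/

/-- The number with given binary digits, the least significant first. -/
def bitsVal : List Bool → ℕ
  | [] => 0
  | b :: l => 2 * bitsVal l + b.toNat

theorem bitsVal_encodePosNum (p : PosNum) : bitsVal (encodePosNum p) = p := by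
  induction p with
  | one => rfl
  | bit0 p ih => simp [encodePosNum, bitsVal, ih]; omega
  | bit1 p ih => simp [encodePosNum, bitsVal, ih]; omega

theorem bitsVal_encodeNat (k : ℕ) : bitsVal (encodeNat k) = k := by
  conv_rhs => rw [← Num.to_of_nat k]
  rw [encodeNat]
  generalize (k : Num) = m
  cases m with
  | zero => rfl
  | pos p => exact bitsVal_encodePosNum p

theorem exists_encodeWords_eq {ws : List (List Bool)} (h : ws ≠ []) :
    ∃ l, encodeWords ws = l ++ [Γ'.comma] := by
  obtain ⟨ws, w, rfl⟩ := List.eq_nil_or_concat ws |>.resolve_left h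
  exact ⟨encodeWords ws ++ w.map Γ'.bit, by simp [encodeWords]⟩

/-- The characteristic vector is present even for `n = 0`, so a comma always precedes the digits of
`k`; there a scan from the right end stops. -/
theorem exists_encode_eq (I : SFVSInstance) : ∃ l, I.encode =
    l ++ Γ'.comma :: ((encodeNat I.k).map Γ'.bit ++ [Γ'.comma]) := by
  classical
  obtain ⟨l, hl⟩ := exists_encodeWords_eq (List.cons_ne_nil
    ((List.finRange I.n).map fun i => decide (i ∈ I.T))
    ((List.finRange I.n).map fun i => (List.finRange I.n).map fun j => decide (I.G.Adj i j)))
  refine ⟨l, ?_⟩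
  have : I.encode = encodeWords (((List.finRange I.n).map fun i => decide (i ∈ I.T)) ::
      ((List.finRange I.n).map fun i => (List.finRange I.n).map fun j => decide (I.G.Adj i j))) ++
      encodeWords [encodeNat I.k] := by
    simp only [SFVSInstance.encode, SFVSInstance.words, encodeWords, List.flatMap_append]
  rw [this, hl]
  simp [encodeWords]

theorem encode_comma (I : SFVSInstance) : I.encode[I.n]? = some .comma := by
  simp [SFVSInstance.encode, SFVSInstance.words, encodeWords_cons]

theorem Store.left_at' {R : Type} [DecidableEq R] (s : Store R) (w : List Γ') (p : ℕ)
    (hp : p < w.length) : Act.left.apply (s.at' w (p + 1)) = s.at' w p := by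
  refine Store.ext' ?_ ?_ rfl fun _ => rfl
  · simp only [Act.apply, Store.at']
    rw [List.take_add_one, List.reverse_append]
    simp [List.getElem?_eq_getElem hp]
  · simp only [Act.apply, Store.at']
    rw [List.take_add_one, List.reverse_append]
    simp [List.getElem?_eq_getElem hp]

/-- Whether a symbol is a bit. -/
def isBit (o : Option Γ') : Bool := isTrue o || decide (o = some (.bit false))

theorem isBit_bit (b : Bool) : isBit (some (.bit b)) = true := by cases b <;> rfl

variable {D : ℕ}

/-- Set `size` to the number of vertices. -/
def readSize : Prog (Reg D) := .seq (.loop (.inp isBit) (acts [.inc .size, .right])) rewind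

theorem runs_readSize (I : SFVSInstance) :
    Runs readSize (.init (Reg D) I.encode) ((Store.init (Reg D) I.encode).set .size I.n)
      (6 * I.encode.length + 2) := by
  classical
  have hn := n_le_length_encode I
  have h := Runs.loop (R := Reg D) (c := .inp isBit) (p := acts [.inc .size, .right]) (t := 3) I.n
    (fun i => ((Store.init (Reg D) I.encode).set .size i).at' I.encode i)
    (by
      intro i hi
      simp only [Test.eval, Store.inp_at', List.head?_drop]
      rw [getElem?_encode_memT I ⟨i, hi⟩]
      exact isBit_bit _)
    (by
      simp only [Test.eval, Store.inp_at', List.head?_drop]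
      rw [encode_comma]; rfl)
    (by
      intro i hi
      refine (runs_acts _ _).conv ?_ le_rfl
      simp only [List.foldl_cons, List.foldl_nil, Act.apply.eq_6, Store.set_at', Store.right_at']
      ext x <;> simp [Store.reg_set]
      split_ifs <;> rfl)
  have e0 : ((Store.init (Reg D) I.encode).set .size 0).at' I.encode 0 =
      .init (Reg D) I.encode := by
    refine Store.ext' (by simp [Store.init]) (by simp [Store.init]) rfl fun x => ?_
    simp [Store.reg_set, Store.init]
  simp only [e0] at h
  refine (h.seq (runs_rewind_at' _ _ _)).conv ?_ (by omega)
  rw [Store.at'_zero] <;> rfl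

/-- Double the register `bound`. -/
def double : Prog (Reg D) :=
  .seq (move .bound .t₂) <| .seq (copy .t₂ .bound .t₁) (move .t₂ .bound)

theorem runs_double (s : Store (Reg D)) (h₁ : s.reg .t₁ = 0) (h₂ : s.reg .t₂ = 0) :
    Runs double s (s.set .bound (2 * s.reg .bound)) (17 * s.reg .bound + 4) := by
  refine ((runs_move (by simp) s).seq ((runs_copy (by simp) (by simp) (by simp) _ ?_).seq
    (runs_move (by simp) _))).conv ?_ ?_
  · simp [Store.reg_set, h₁]
  · ext x <;> simp [Store.reg_set]
    split_ifs <;> simp_all; omega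
  · simp [Store.reg_set, h₂]; omega

/-- Replace the register `bound` by its minimum with the register `size`. -/
def cap : Prog (Reg D) :=
  .seq (copy .size .t₂ .t₁) <| .seq (.loop (.pos .t₂) <| .seq
    (.ite (.pos .bound) (acts [.dec .bound, .inc .t₃]) (.act .nop)) (.act (.dec .t₂))) <|
    .seq (clear .bound) (move .t₃ .bound)

/-- In `size` rounds one unit at a time passes from `bound` to `t₃` while any is left. This collects
the minimum; the rest of `bound` is discarded. -/
theorem runs_cap (s : Store (Reg D)) (h₁ : s.reg .t₁ = 0) (h₂ : s.reg .t₂ = 0)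
    (h₃ : s.reg .t₃ = 0) :
    Runs cap s (s.set .bound (min (s.reg .bound) (s.reg .size)))
      (20 * s.reg .size + 2 * s.reg .bound + 5) := by
  have h := Runs.loop (c := .pos .t₂) (p := .seq
    (.ite (.pos .bound) (acts [.dec .bound, .inc .t₃]) (.act .nop)) (.act (.dec .t₂)))
    (t := 5) (s.reg .size)
    (fun i => ((s.set .t₂ (s.reg .size - i)).set .bound (s.reg .bound - i)).set .t₃
      (min (s.reg .bound) i))
    (by intro i hi; simp [Test.eval, Store.reg_set]; omega)
    (by simp [Test.eval, Store.reg_set]) (by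
      intro i hi
      refine Runs.seq (t₁ := 1 + 3) (s₂ := ((s.set .t₂ (s.reg .size - i)).set .bound
          (s.reg .bound - (i + 1))).set .t₃ (min (s.reg .bound) (i + 1)))
        (Runs.ite (fun hc => (runs_acts _ _).conv ?_ le_rfl)
          fun hc => (Runs.act _ _).conv ?_ (by omega)) ((Runs.act _ _).conv ?_ le_rfl)
      · have hx : i < s.reg .bound := by simpa [Test.eval, Store.reg_set] using hc
        ext x <;> simp [Act.apply, Store.reg_set]
        split_ifs <;> simp_all <;> omega
      · have hx : s.reg .bound ≤ i := by simpa [Test.eval, Store.reg_set] using hc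
        ext x <;> simp [Act.apply, Store.reg_set]
        split_ifs <;> simp_all <;> omega
      · ext x <;> simp [Act.apply, Store.reg_set]
        split_ifs <;> simp_all <;> omega)
  have e0 : ((s.set .t₂ (s.reg .size - 0)).set .bound (s.reg .bound - 0)).set .t₃
      (min (s.reg .bound) 0) = s.set .t₂ (s.reg .t₂ + s.reg .size) := by
    ext x <;> simp [Store.reg_set]
    split_ifs <;> simp_all
  simp only [e0] at h
  refine ((runs_copy (by simp) (by simp) (by simp) s h₁).seq (h.seq ((runs_clear _ _).seq
    (runs_move (by simp) _)))).conv ?_ ?_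
  · ext x <;> simp [Store.reg_set]
    split_ifs <;> simp_all
  · simp [Store.reg_set]; omega

/-- Set `bound` to the minimum of `k` and the number of vertices. -/
def readBound : Prog (Reg D) :=
  .seq (.loop (.inp Option.isSome) (.act .right)) <| .seq (.act .left) <|
    .seq (.loop (.aux isBit) <| .seq (.act .left) <| .seq double <|
      .seq (.ite (.inp isTrue) (.act (.inc .bound)) (.act .nop)) cap) rewind

/-- The number `k` may be exponential in the input length, too large for a unary register, so it is
capped at `n` after each digit. The digits are read from the right, the most significant first, by
Horner's rule. Capping the intermediate value is harmless because `min (2 * min v n + b) n = min (2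
* v + b) n`. -/
theorem runs_readBound (I : SFVSInstance) (s : Store (Reg D)) (hi : s.inp = I.encode)
    (ha : s.aux = []) (hs : s.reg .size = I.n) (hb : s.reg .bound = 0) (h₁ : s.reg .t₁ = 0)
    (h₂ : s.reg .t₂ = 0) (h₃ : s.reg .t₃ = 0) :
    Runs readBound s (s.set .bound (min I.k I.n))
      (50 * I.encode.length * I.encode.length + 50 * I.encode.length + 10) := by
  have hn := n_le_length_encode I
  obtain ⟨l, hl⟩ := exists_encode_eq I
  have hk := bitsVal_encodeNat I.k
  set bs := encodeNat I.k
  set w := I.encode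
  have hw : w.length = l.length + 1 + bs.length + 1 := by rw [hl]; simp; omega
  have hbit : ∀ (i : ℕ) (hi : i < bs.length), w[l.length + 1 + i]? = some (.bit bs[i]) := by
    intro i hi
    rw [hl, List.getElem?_append_right (by omega)]
    rw [show l.length + 1 + i - l.length = i + 1 by omega]
    simp [List.getElem?_append_left, hi]
  have hcomma : w[l.length]? = some .comma := by
    rw [hl, List.getElem?_append_right (by omega)]; simp
  have haux : ∀ (s : Store (Reg D)) (p : ℕ), p < w.length →
      (s.at' w (p + 1)).aux.head? = w[p]? := by
    intro s p hp
    rw [Store.aux_at', List.take_add_one, List.reverse_append]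
    simp [List.getElem?_eq_getElem hp]
  have r1 : Runs (.loop (.inp Option.isSome) (.act .right)) s (s.at' w w.length)
      (w.length * (1 + 1) + 1) := by
    have := Runs.loop (c := .inp Option.isSome) (p := .act .right) (t := 1) w.length
      (fun i => s.at' w i) (by intro i hi; simp [Test.eval, hi]) (by simp [Test.eval])
      (fun i hi => (Runs.act _ _).conv (Store.right_at' _ _ _) le_rfl)
    rwa [Store.at'_zero s w hi ha] at this
  have r2 : Runs (.act .left) (s.at' w w.length) (s.at' w (l.length + 1 + bs.length)) 1 := by
    refine (Runs.act _ _).conv ?_ le_rfl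
    rw [hw]
    exact Store.left_at' _ _ _ (by omega)
  have r3 := Runs.loop (c := .aux isBit) (p := .seq (.act .left) <| .seq double <|
      .seq (.ite (.inp isTrue) (.act (.inc .bound)) (.act .nop)) cap)
    (t := 45 * w.length + 20) bs.length
    (fun i => (s.set .bound (min (bitsVal (bs.drop (bs.length - i))) I.n)).at' w
      (l.length + 1 + (bs.length - i)))
    (by
      intro i hi
      obtain ⟨j, hj⟩ : ∃ j, bs.length - i = j + 1 := ⟨bs.length - i - 1, by omega⟩
      simp only [Test.eval]
      rw [hj, ← add_assoc, haux _ _ (by omega), hbit j (by omega)]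
      exact isBit_bit _)
    (by
      simp only [Test.eval, Nat.sub_self, add_zero]
      rw [haux _ _ (by omega), hcomma]
      rfl)
    (by
      intro i hi
      obtain ⟨j, hj⟩ : ∃ j, bs.length - i = j + 1 := ⟨bs.length - i - 1, by omega⟩
      have hj' : bs.length - (i + 1) = j := by omega
      have hjb : j < bs.length := by omega
      simp only [hj, hj']
      set v := bitsVal (bs.drop (j + 1)) with hv
      have hdrop : bitsVal (bs.drop j) = 2 * v + bs[j].toNat := by
        rw [List.drop_eq_getElem_cons hjb]; rfl
      have q1 : Runs (.act .left) ((s.set .bound (min v I.n)).at' w (l.length + 1 + (j + 1)))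
          ((s.set .bound (min v I.n)).at' w (l.length + 1 + j)) 1 :=
        (Runs.act _ _).conv (Store.left_at' _ w (l.length + 1 + j) (by omega)) le_rfl
      have q2 := runs_double ((s.set .bound (min v I.n)).at' w (l.length + 1 + j))
        (by simp [Store.reg_set, h₁]) (by simp [Store.reg_set, h₂])
      have q3 : Runs (.ite (.inp isTrue) (.act (.inc .bound)) (.act .nop))
          ((s.set .bound (2 * min v I.n)).at' w (l.length + 1 + j))
          ((s.set .bound (2 * min v I.n + bs[j].toNat)).at' w (l.length + 1 + j)) (1 + 1) := by
        refine Runs.ite (fun hc => (Runs.act _ _).conv ?_ le_rfl)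
          fun hc => (Runs.act _ _).conv ?_ le_rfl
        · have : bs[j] = true := by simpa [Test.eval, hbit j hjb, isTrue] using hc
          simp only [this]
          ext x <;> simp [Act.apply, Store.reg_set]
          split_ifs <;> simp_all
        · have : bs[j] = false := by simpa [Test.eval, hbit j hjb, isTrue] using hc
          simp [this, Act.apply]
      have q4 := runs_cap ((s.set .bound (2 * min v I.n + bs[j].toNat)).at' w (l.length + 1 + j))
        (by simp [Store.reg_set, h₁]) (by simp [Store.reg_set, h₂]) (by simp [Store.reg_set, h₃])
      refine (q1.seq (Runs.seq (s₂ := (s.set .bound (2 * min v I.n)).at' w (l.length + 1 + j))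
        (q2.conv ?_ le_rfl) (q3.seq q4))).conv ?_ ?_
      · ext x <;> simp [Store.reg_set]
        split_ifs <;> simp_all
      · have : min (2 * min v I.n + bs[j].toNat) I.n = min (bitsVal (bs.drop j)) I.n := by
          rw [hdrop]; omega
        ext x <;> simp [Store.reg_set, hs, this]
        split_ifs <;> simp_all
      · simp [Store.reg_set, hs]
        have := Bool.toNat_le bs[j]
        omega)
  have e0 : (s.set .bound (min (bitsVal (bs.drop (bs.length - 0))) I.n)).at' w
      (l.length + 1 + (bs.length - 0)) = s.at' w (l.length + 1 + bs.length) := by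
    ext x <;> simp [Store.reg_set]
    rintro rfl
    simp [bitsVal, hb]
  simp only [e0] at r3
  refine (r1.seq (r2.seq (r3.seq (runs_rewind_at' _ _ _)))).conv ?_ ?_
  · rw [Store.at'_zero _ w (by exact hi) (by exact ha)]
    simp [hk]
  · have : bs.length * (45 * w.length + 20 + 1) ≤ w.length * (45 * w.length + 20 + 1) :=
      Nat.mul_le_mul_right _ (by omega)
    nlinarith

/-- Erase everything but the result, and write the result. -/
def finish : Prog (Reg D) :=
  .seq (clear .size) <| .seq (clear .bound) <| .seq (.loop (.inp Option.isSome) (.act .erase)) <|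
    .ite (.pos .res) (.seq (.act (.dec .res)) (.act (.write true))) (.act (.write false))

/-- A halting configuration of the machine must have every stack empty but the output, which is why
the tape and the registers are erased. -/
theorem runs_finish (I : SFVSInstance) (s : Store (Reg D)) (h : Ready I 0 s) (ho : s.out = [])
    (Q : Prop) [Decidable Q] (b : Bool) (hb : b = true ↔ Q) :
    Runs finish (s.set .res (if Q then 1 else 0)) (.final (Reg D) b)
      (6 * I.encode.length + 10) := by
  have hn := n_le_length_encode I
  have r := Runs.loop (c := .inp Option.isSome) (p := .act .erase) (t := 1) I.encode.length
    (fun i => { (((s.set .res (if Q then 1 else 0)).set .size 0).set .bound 0) with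
      inp := I.encode.drop i })
    (by intro i hi; simp [Test.eval, hi]) (by simp [Test.eval])
    (fun i hi => (Runs.act _ _).conv (by simp [Act.apply]) le_rfl)
  have hreg : ∀ x, x ≠ .res → x ≠ .size → x ≠ .bound → s.reg x = 0 := by
    intro x h1 h2 h3
    cases x with
    | res => exact absurd rfl h1
    | size => exact absurd rfl h2
    | bound => exact absurd rfl h3
    | t₁ => exact h.t₁
    | t₂ => exact h.t₂
    | t₃ => exact h.t₃
    | var i => exact h.var i (Nat.zero_le _)
    | cnt i => exact h.cnt i (Nat.zero_le _)
    | acc i => exact h.acc i (Nat.zero_le _)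
  have r3 : Runs (.ite (.pos .res) (.seq (.act (.dec .res)) (.act (.write true)))
      (.act (.write false)))
      { (((s.set .res (if Q then 1 else 0)).set .size 0).set .bound 0) with
        inp := I.encode.drop I.encode.length } (.final (Reg D) b) (1 + 2) := by
    refine Runs.ite (fun hc => ((Runs.act _ _).seq (Runs.act _ _)).conv ?_ le_rfl)
      fun hc => (Runs.act _ _).conv ?_ (by omega)
    · have hQ : Q := by
        by_contra hQ
        simp [Test.eval, Store.set, Function.update, hQ] at hc
      have : b = true := hb.2 hQ
      subst this
      refine Store.ext' (by simp [Act.apply, Store.final]) (by simp [Act.apply, Store.final, h.aux])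
        (by simp [Act.apply, Store.final, ho]) fun x => ?_
      simp only [Act.apply, Store.final, Store.set, Function.update_apply]
      split_ifs <;> simp_all
    · have hQ : ¬ Q := by
        intro hQ
        simp [Test.eval, Store.set, Function.update, hQ] at hc
      have : b = false := by cases b <;> simp_all
      subst this
      refine Store.ext' (by simp [Act.apply, Store.final]) (by simp [Act.apply, Store.final, h.aux])
        (by simp [Act.apply, Store.final, ho]) fun x => ?_
      simp only [Act.apply, Store.final, Store.set, Function.update_apply]
      split_ifs <;> simp_all
  have e0 : { (((s.set .res (if Q then 1 else 0)).set .size 0).set .bound 0) with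
      inp := I.encode.drop 0 } = ((s.set .res (if Q then 1 else 0)).set .size 0).set .bound 0 := by
    refine Store.ext' (by simp [h.inp]) rfl rfl fun _ => rfl
  simp only [e0] at r
  refine ((runs_clear _ _).seq ((runs_clear _ _).seq (r.seq r3))).mono ?_
  simp [Store.reg_set, h.size, h.bound]
  omega

/-- The problems that are defined by a first-order sentence with counting can be solved in
polynomial time. -/
theorem polyTimeSolvableOn_formula (φ : Formula Empty) (C Q : SFVSInstance → Prop)
    (h : ∀ I, C I → (φ.Holds I Empty.elim ↔ Q I)) :
    PolyTimeSolvableOn SFVSInstance.encode C Q := by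
  classical
  obtain ⟨P, hP⟩ := runs_formula φ
  refine polyTimeSolvableOn_of_prog (R := Reg φ.depth) _ _ _
    (.seq readSize <| .seq readBound <| .seq (φ.prog φ.depth Empty.elim 0) finish)
    (P + 50 * .X * .X + 100 * .X + 50) fun I hI b hb => ?_
  have r1 := runs_readSize (D := φ.depth) I
  have r2 := runs_readBound I ((Store.init (Reg φ.depth) I.encode).set .size I.n) rfl rfl
    (by simp) (by simp [Store.reg_set, Store.init]) (by simp [Store.reg_set, Store.init])
    (by simp [Store.reg_set, Store.init]) (by simp [Store.reg_set, Store.init])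
  have hr : Ready I 0 (((Store.init (Reg φ.depth) I.encode).set .size I.n).set .bound
      (min I.k I.n)) := by
    constructor <;> simp [Store.reg_set, Store.init]
  have r3 := hP φ.depth 0 Empty.elim (by omega) (fun i => i.elim) I _ Empty.elim hr fun i => i.elim
  have r4 := runs_finish I _ hr rfl (φ.Holds I Empty.elim) b (hb.trans (h I hI).symm)
  obtain ⟨u, hu, he⟩ := r1.seq (r2.seq (r3.seq r4))
  refine ⟨u, hu.trans ?_, he⟩
  simp only [Polynomial.eval_add, Polynomial.eval_mul, Polynomial.eval_X, Polynomial.eval_ofNat]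
  omega


/-! ### Cycles through `T`, cliques and bounded walks -/

open Relation

section Graphs

variable {V : Type*} (G : SimpleGraph V) (T : Finset V)

/-- One step of a walk that stays in `F` and avoids `t`. -/
def Step (F : V → Prop) (t x y : V) : Prop := G.Adj x y ∧ F y ∧ y ≠ t

/-- No vertex of `T` lies on a cycle of the subgraph induced by `F`. -/
def NoTCycle (F : V → Prop) : Prop :=
  ∀ t ∈ T, F t → ∀ a b, F a → F b → a ≠ b → G.Adj t a → G.Adj t b →
    ¬ ReflTransGen (Step G F t) a b

/-- `Q` induces no path on three vertices. -/
def P3Free (Q : V → Prop) : Prop :=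
  ∀ x y z, Q x → Q y → Q z → G.Adj x y → G.Adj y z → x ≠ z → G.Adj x z

/-- No vertex of `T` lies on a triangle of the subgraph induced by `F`. -/
def NoTTriangle (F : V → Prop) : Prop :=
  ∀ x y z, F x → F y → F z → G.Adj x y → G.Adj x z → G.Adj y z → x ∉ T

variable {G T}

theorem exists_walk_of_reflTransGen {F : V → Prop} {t a b : V}
    (h : ReflTransGen (Step G F t) a b) (ha : F a) (hat : a ≠ t) :
    ∃ p : G.Walk a b, ∀ x ∈ p.support, F x ∧ x ≠ t := by
  induction h with
  | refl => exact ⟨.nil, by simp [ha, hat]⟩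
  | tail _ hs ih =>
    obtain ⟨p, hp⟩ := ih
    refine ⟨p.concat hs.1, fun x hx => ?_⟩
    rw [SimpleGraph.Walk.support_concat, List.mem_append,
      List.mem_singleton] at hx
    rcases hx with hx | rfl
    · exact hp x hx
    · exact hs.2

theorem reflTransGen_of_walk {F : V → Prop} {t a b : V} (p : G.Walk a b)
    (h : ∀ x ∈ p.support, F x ∧ x ≠ t) : ReflTransGen (Step G F t) a b := by
  induction p with
  | nil => exact .refl
  | cons hadj p ih =>
    refine .head ⟨hadj, h _ ?_⟩ (ih fun x hx => h x ?_)
    · simp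
    · simp [hx]

/-- A cycle through `t` amounts to two distinct neighbours of `t` joined by a walk that avoids `t`:
shorten the walk to a path and close it at `t`, or conversely rotate the cycle to `t` and cut off
its first and last edge. -/
theorem isSubsetFVS_iff (S : Finset V) : IsSubsetFVS G T S ↔ NoTCycle G T (· ∉ S) := by
  classical
  constructor
  · intro h t ht htS a b ha hb hab hta htb hr
    obtain ⟨p, hp⟩ := exists_walk_of_reflTransGen hr ha hta.ne'
    have hq : ∀ x ∈ p.bypass.support, x ∉ S ∧ x ≠ t := fun x hx =>
      hp x (p.support_bypass_subset_support hx)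
    have hpath : (p.bypass.concat htb.symm).IsPath :=
      p.bypass_isPath.concat (fun hx => (hq t hx).2 rfl) _
    have hc : (SimpleGraph.Walk.cons hta (p.bypass.concat htb.symm)).IsCycle := by
      rw [SimpleGraph.Walk.cons_isCycle_iff]
      refine ⟨hpath, fun he => ?_⟩
      rw [SimpleGraph.Walk.edges_concat, List.concat_eq_append, List.mem_append,
      List.mem_singleton] at he
      rcases he with he | he
      · exact (hq t (SimpleGraph.Walk.fst_mem_support_of_mem_edges _ he)).2 rfl
      · rw [Sym2.eq_iff] at he
        rcases he with ⟨rfl, _⟩ | ⟨_, rfl⟩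
        · exact G.irrefl htb
        · exact hab rfl
    obtain ⟨x, hx, hxS⟩ := h t _ hc ⟨t, by simp, ht⟩
    rw [SimpleGraph.Walk.support_cons, SimpleGraph.Walk.support_concat, List.mem_cons,
      List.mem_append,
      List.mem_singleton] at hx
    rcases hx with rfl | hx | rfl
    · exact htS hxS
    · exact (hq x hx).1 hxS
    · exact htS hxS
  · intro h v c hc ⟨t, htc, htT⟩
    by_contra hS
    push Not at hS
    have hc' := (SimpleGraph.Walk.isCycle_rotate htc).2 hc
    have hS' : ∀ x ∈ (c.rotate t htc).support, x ∉ S := fun x hx =>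
      hS x ((SimpleGraph.Walk.mem_support_rotate_iff _ _ _).1 hx)
    generalize c.rotate t htc = c' at hc' hS'
    cases c' with
    | nil => exact SimpleGraph.Walk.not_isCycle_nil hc'
    | @cons _ a _ hta p =>
      rw [SimpleGraph.Walk.cons_isCycle_iff] at hc'
      obtain ⟨hp, he⟩ := hc'
      have hp' := hp.reverse
      have he' : s(t, a) ∉ p.reverse.edges := by simpa using he
      have hS'' : ∀ x ∈ p.reverse.support, x ∉ S := fun x hx => hS' x (by
        simp only [SimpleGraph.Walk.support_reverse, List.mem_reverse] at hx
        simp [hx])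
      generalize p.reverse = q at hp' he' hS''
      cases q with
      | nil => exact G.irrefl hta
      | @cons _ b _ htb q =>
        rw [SimpleGraph.Walk.cons_isPath_iff] at hp'
        refine h t htT (hS'' t (by simp)) b a (hS'' b (by simp)) (hS'' a (by simp)) ?_ htb hta
          (reflTransGen_of_walk q fun x hx => ⟨hS'' x (by simp [hx]), ?_⟩)
        · rintro rfl
          simp at he'
        · rintro rfl
          exact hp'.2 hx

theorem NoTCycle.noTTriangle {F : V → Prop} (h : NoTCycle G T F) : NoTTriangle G T F :=
  fun x y z hx hy hz hxy hxz hyz hT =>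
    h x hT hx y z hy hz hyz.ne hxy hxz (.single ⟨hyz, hz, hxz.ne'⟩)

/-- Otherwise `t, a, x, b` would be a four-cycle through `t`. -/
theorem NoTCycle.not_adj_of_adj {F : V → Prop} (h : NoTCycle G T F) {t a b x : V} (ht : t ∈ T)
    (hF : F t) (ha : F a) (hb : F b) (hx : F x) (hab : a ≠ b) (hxt : x ≠ t) (hta : G.Adj t a)
    (htb : G.Adj t b) (hax : G.Adj a x) : ¬ G.Adj x b := fun hxb =>
  h t ht hF a b ha hb hab hta htb (.head ⟨hax, hx, hxt⟩ (.single ⟨hxb, hb, htb.ne'⟩))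

/-- The components of a graph without induced `P₃` are cliques. -/
theorem P3Free.eq_or_adj {F : V → Prop} {r : V} (h : P3Free G fun v => F v ∧ v ≠ r) {a b : V}
    (hr : ReflTransGen (Step G F r) a b) (ha : F a) (har : a ≠ r) : a = b ∨ G.Adj a b := by
  induction hr with
  | refl => exact .inl rfl
  | @tail c d hc hs ih =>
    have hcF : F c ∧ c ≠ r := by
      cases hc with
      | refl => exact ⟨ha, har⟩
      | tail _ hs => exact hs.2
    by_cases had : a = d
    · exact .inl had
    · rcases ih with rfl | hac
      · exact .inr hs.1
      · exact .inr (h a c d ⟨ha, har⟩ hcF hs.2 hac hs.1 had)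

/-- A walk from `r` to another vertex has a last step away from `r`. -/
theorem exists_step_of_reflTransGen {F : V → Prop} {t r b : V}
    (h : ReflTransGen (Step G F t) r b) (hb : b ≠ r) :
    ∃ y, G.Adj r y ∧ F y ∧ y ≠ t ∧ y ≠ r ∧ ReflTransGen (Step G F r) y b := by
  induction h with
  | refl => exact absurd rfl hb
  | @tail c d hc hs ih =>
    by_cases hcr : c = r
    · subst hcr
      exact ⟨d, hs.1, hs.2.1, hs.2.2, hb, .refl⟩
    · obtain ⟨y, h1, h2, h3, h4, h5⟩ := ih hcr
      exact ⟨y, h1, h2, h3, h4, h5.tail ⟨hs.1, hs.2.1, hb⟩⟩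

/-- A `T`-cycle always yields a `T`-triangle. Let `a`, `b` be the neighbours on it of `t ∈ T`. If
neither is `r`, they lie in one clique of `F - r`, so `a`, `b`, `t` form a triangle. If `a = r`, let
`y` be the vertex after the last visit to `r`; it lies in the clique of `b`, and the triangle is `t,
r, b` when `y = b` and `t, y, b` otherwise. The case `b = r` is symmetric. -/
theorem noTCycle_of_p3Free {F : V → Prop} {r : V} (h : P3Free G fun v => F v ∧ v ≠ r)
    (htri : NoTTriangle G T F) : NoTCycle G T F := by
  have key : ∀ t ∈ T, F t → t ≠ r → ∀ b, F b → r ≠ b → G.Adj t r → G.Adj t b →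
      F r → ¬ ReflTransGen (Step G F t) r b := by
    intro t ht hF htr b hb hrb har hab hr hw
    obtain ⟨y, h1, h2, h3, h4, h5⟩ := exists_step_of_reflTransGen hw hrb.symm
    rcases h.eq_or_adj h5 h2 h4 with rfl | hyb
    · exact htri t r y hF hr h2 har hab h1 ht
    · have hyt := h y b t ⟨h2, h4⟩ ⟨hb, hrb.symm⟩ ⟨hF, htr⟩ hyb hab.symm h3
      exact htri t y b hF h2 hb hyt.symm hab hyb ht
  intro t ht hF a b ha hb hab hta htb hw
  by_cases htr : t = r
  · subst htr
    rcases h.eq_or_adj hw ha hta.ne' with rfl | hadj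
    · exact hab rfl
    · exact htri t a b hF ha hb hta htb hadj ht
  · by_cases har : a = r
    · subst har
      exact key t ht hF htr b hb hab hta htb ha hw
    · by_cases hbr : b = r
      · subst hbr
        refine key t ht hF htr a ha (Ne.symm hab) htb hta hb ?_
        obtain ⟨p, hp⟩ := exists_walk_of_reflTransGen hw ha hta.ne'
        exact reflTransGen_of_walk p.reverse fun x hx => hp x (by simpa using hx)
      · exact htri t a b hF ha hb hta htb
          (h a t b ⟨ha, har⟩ ⟨hF, htr⟩ ⟨hb, hbr⟩ hta.symm htb hab) ht

/-- Every use of the hypothesis on the graph passes through this form: an induced `P₃` together with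
`s` independent vertices away from it. -/
theorem not_isFreeOf {s : ℕ} (L : Finset V) (hs : s ≤ L.card)
    (hL : ∀ x ∈ L, ∀ y ∈ L, ¬ G.Adj x y) {p q w : V} (hpq : G.Adj p q) (hqw : G.Adj q w)
    (hpw : p ≠ w) (hpw' : ¬ G.Adj p w)
    (hx : ∀ x ∈ L, ∀ z, z = p ∨ z = q ∨ z = w → x ≠ z ∧ ¬ G.Adj x z) :
    ¬ IsFreeOf (sP1P3 s) G := by
  obtain ⟨L', hL', rfl⟩ := Finset.exists_subset_card_eq hs
  let f : Fin L'.card → V := fun i => L'.equivFin.symm i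
  have hf : ∀ i, f i ∈ L := fun i => hL' (L'.equivFin.symm i).2
  have hfi : Function.Injective f := fun i j h => L'.equivFin.symm.injective (Subtype.ext h)
  have hg : ∀ j : Fin 3, (![p, q, w] j = p ∨ ![p, q, w] j = q ∨ ![p, q, w] j = w) := by
    intro j; fin_cases j <;> simp
  rw [IsFreeOf, not_not]
  refine ⟨⟨⟨Sum.elim f ![p, q, w], ?_⟩, ?_⟩⟩
  · refine hfi.sumElim ?_ fun i j => (hx _ (hf i) _ (hg j)).1
    intro i j
    fin_cases i <;> fin_cases j <;> simp [hpq.ne, hpq.ne', hqw.ne, hqw.ne', hpw, hpw.symm]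
  · rintro (i | i) (j | j)
    · simpa using hL _ (hf i) _ (hf j)
    · simpa using (hx _ (hf i) _ (hg j)).2
    · have := (hx _ (hf j) _ (hg i)).2
      simpa [G.adj_comm] using this
    · simp only [Function.Embedding.coeFn_mk, Sum.elim_inr, SimpleGraph.sum_adj_inr,
        SimpleGraph.pathGraph_adj]
      have hpw'' : ¬ G.Adj w p := fun h => hpw' h.symm
      fin_cases i <;> fin_cases j <;> simp [hpq, hpq.symm, hqw, hqw.symm, hpw', hpw'']

/-- There is a walk of length at most `d` from `a` to `b` that stays in `F` and avoids `t`. -/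
def Reach (G : SimpleGraph V) (F : V → Prop) (t : V) : ℕ → V → V → Prop
  | 0, a, b => a = b
  | d + 1, a, b => a = b ∨ ∃ z, G.Adj a z ∧ F z ∧ z ≠ t ∧ Reach G F t d z b

theorem Reach.refl {F : V → Prop} {t : V} (d : ℕ) (a : V) : Reach G F t d a a := by
  cases d with
  | zero => rfl
  | succ d => exact .inl rfl

theorem Reach.reflTransGen {F : V → Prop} {t : V} {d : ℕ} {a b : V} (h : Reach G F t d a b) :
    ReflTransGen (Step G F t) a b := by
  induction d generalizing a with
  | zero => obtain rfl : a = b := h; exact .refl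
  | succ d ih =>
    rcases h with rfl | ⟨z, h1, h2, h3, h4⟩
    · exact .refl
    · exact .head ⟨h1, h2, h3⟩ (ih h4)

theorem Reach.mono {F : V → Prop} {t : V} {d e : ℕ} {a b : V} (h : Reach G F t d a b)
    (hde : d ≤ e) : Reach G F t e a b := by
  induction d generalizing a e with
  | zero => obtain rfl : a = b := h; exact .refl _ _
  | succ d ih =>
    obtain ⟨e, rfl⟩ : ∃ e', e = e' + 1 := ⟨e - 1, by omega⟩
    rcases h with rfl | ⟨z, h1, h2, h3, h4⟩
    · exact .refl _ _
    · exact .inr ⟨z, h1, h2, h3, ih h4 (by omega)⟩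

theorem Reach.add {F : V → Prop} {t : V} {d e : ℕ} {a b c : V} (h : Reach G F t d a b)
    (h' : Reach G F t e b c) : Reach G F t (d + e) a c := by
  induction d generalizing a with
  | zero => obtain rfl : a = b := h; simpa using h'
  | succ d ih =>
    rcases h with rfl | ⟨z, h1, h2, h3, h4⟩
    · exact h'.mono (by omega)
    · rw [Nat.add_right_comm]
      exact .inr ⟨z, h1, h2, h3, ih h4⟩

/-- Minimality of `d` rules out stopping early, so the walk takes exactly `d` steps. -/
theorem Reach.exists_seq {F : V → Prop} {t : V} {d : ℕ} {a b : V} (h : Reach G F t d a b)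
    (hmin : ∀ e < d, ¬ Reach G F t e a b) :
    ∃ v : ℕ → V, v 0 = a ∧ v d = b ∧ ∀ i < d, Step G F t (v i) (v (i + 1)) := by
  induction d generalizing a with
  | zero => exact ⟨fun _ => a, rfl, h, by simp⟩
  | succ d ih =>
    rcases h with rfl | ⟨z, h1, h2, h3, h4⟩
    · exact absurd (.refl 0 a) (hmin 0 (by omega))
    · obtain ⟨v, hv0, hvd, hv⟩ := ih h4 fun e he hr =>
        hmin (e + 1) (by omega) (.inr ⟨z, h1, h2, h3, hr⟩)
      refine ⟨fun i => Nat.casesOn i a v, rfl, hvd, fun i hi => ?_⟩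
      cases i with
      | zero => subst hv0; exact ⟨h1, h2, h3⟩
      | succ i => exact hv i (by omega)

theorem reach_of_seq {F : V → Prop} {t : V} {v : ℕ → V} {d : ℕ}
    (h : ∀ i < d, Step G F t (v i) (v (i + 1))) (i k : ℕ) (hk : i + k ≤ d) :
    Reach G F t k (v i) (v (i + k)) := by
  induction k generalizing i with
  | zero => rfl
  | succ k ih =>
    obtain ⟨h1, h2, h3⟩ := h i (by omega)
    have := ih (i + 1) (by omega)
    rw [show i + 1 + k = i + (k + 1) by omega] at this
    exact .inr ⟨v (i + 1), h1, h2, h3, this⟩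

/-- A shortest walk is an induced path `v 0, …, v d`. If `d > 2s + 2`, then `v 0, v 1, v 2` and the
`s` vertices `v 4, v 6, …, v (2s + 2)` induce `sP₁ + P₃`. This bound turns reachability into a
first-order property. -/
theorem reach_of_reflTransGen {F : V → Prop} {t : V} {s : ℕ} (hG : IsFreeOf (sP1P3 s) G) {a b : V}
    (h : ReflTransGen (Step G F t) a b) : Reach G F t (2 * s + 2) a b := by
  classical
  have hex : ∃ d, Reach G F t d a b := by
    induction h using ReflTransGen.head_induction_on with
    | refl => exact ⟨0, rfl⟩
    | head hs _ ih =>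
      obtain ⟨d, hd⟩ := ih
      exact ⟨d + 1, .inr ⟨_, hs.1, hs.2.1, hs.2.2, hd⟩⟩
  have hd := Nat.find_spec hex
  have hmin := fun e (he : e < Nat.find hex) => Nat.find_min hex he
  generalize Nat.find hex = d at hd hmin
  by_contra hlong
  have hsd : 2 * s + 2 < d := by
    by_contra hle
    exact hlong (hd.mono (by omega))
  obtain ⟨v, rfl, rfl, hv⟩ := hd.exists_seq hmin
  -- A shortcut between two vertices of the walk would shorten the whole walk.
  have short : ∀ i j k, i < j → j ≤ d → k < j - i → ¬ Reach G F t k (v i) (v j) := by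
    intro i j k hij hjd hk hr
    have h1 := reach_of_seq hv 0 i (by omega)
    have h2 := reach_of_seq hv j (d - j) (by omega)
    rw [zero_add] at h1
    rw [show j + (d - j) = d by omega] at h2
    exact hmin (i + k + (d - j)) (by omega) ((h1.add hr).add h2)
  have hne : ∀ i j, i < j → j ≤ d → v i ≠ v j := fun i j hij hjd he =>
    short i j 0 hij hjd (by omega) he
  have hadj : ∀ i j, i + 1 < j → j ≤ d → ¬ G.Adj (v i) (v j) := fun i j hij hjd he => by
    have h1 : Step G F t (v (j - 1)) (v (j - 1 + 1)) := hv (j - 1) (by omega)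
    rw [show j - 1 + 1 = j by omega] at h1
    exact short i j 1 (by omega) hjd (by omega) (.inr ⟨v j, he, h1.2.1, h1.2.2, rfl⟩)
  refine not_isFreeOf (s := s) ((Finset.range s).image fun i => v (4 + 2 * i)) ?_ ?_
    (hv 0 (by omega)).1 (hv 1 (by omega)).1 (hne 0 2 (by omega) (by omega))
    (hadj 0 2 (by omega) (by omega)) ?_ hG
  · rw [Finset.card_image_of_injOn, Finset.card_range]
    intro i hi j hj hij
    simp only [Finset.coe_range, Set.mem_Iio] at hi hj
    by_contra hne'
    rcases Nat.lt_or_gt_of_ne hne' with hlt | hlt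
    · exact hne _ _ (by omega) (by omega) hij
    · exact hne _ _ (by omega) (by omega) hij.symm
  · simp only [Finset.mem_image, Finset.mem_range]
    rintro _ ⟨i, hi, rfl⟩ _ ⟨j, hj, rfl⟩ h
    rcases Nat.lt_trichotomy i j with hlt | rfl | hlt
    · exact hadj _ _ (by omega) (by omega) h
    · exact G.irrefl h
    · exact hadj _ _ (by omega) (by omega) h.symm
  · simp only [Finset.mem_image, Finset.mem_range]
    rintro _ ⟨i, hi, rfl⟩ z hz
    have : ∃ j ≤ 2, z = v j := by
      rcases hz with rfl | rfl | rfl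
      exacts [⟨0, by omega, rfl⟩, ⟨1, by omega, rfl⟩, ⟨2, by omega, rfl⟩]
    obtain ⟨j, hj, rfl⟩ := this
    exact ⟨(hne _ _ (by omega) (by omega)).symm,
      fun h => hadj _ _ (by omega) (by omega) h.symm⟩

end Graphs


/-! ### Solutions that keep many vertices of `T` -/

open Relation

section Structure

variable {V : Type*} {G : SimpleGraph V} {T : Finset V}

-- Greedy choice: taking a vertex and discarding its neighbours costs at most `c` vertices of `D`.
open Classical in
theorem exists_indep_of_degree_lt {c : ℕ} (hc : 0 < c) (s : ℕ) (D : Finset V)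
    (hD : ∀ x ∈ D, (D.filter (G.Adj x)).card < c) (hs : s * c ≤ D.card) :
    ∃ L ⊆ D, L.card = s ∧ ∀ x ∈ L, ∀ y ∈ L, ¬ G.Adj x y := by
  induction s generalizing D with
  | zero => exact ⟨∅, by simp, by simp, by simp⟩
  | succ s ih =>
    obtain ⟨x, hx⟩ : D.Nonempty := Finset.card_pos.1 (by nlinarith)
    set B := insert x (D.filter (G.Adj x)) with hB
    have hBc : B.card ≤ c := (Finset.card_insert_le _ _).trans (hD x hx)
    have hBD : D.card ≤ (D \ B).card + c := by
      have := Finset.le_card_sdiff B D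
      omega
    obtain ⟨L, hL, hLc, hLi⟩ := ih (D \ B) (fun y hy => (Finset.card_le_card
      (Finset.filter_subset_filter _ Finset.sdiff_subset)).trans_lt
        (hD y (Finset.sdiff_subset hy))) (by rw [Nat.succ_mul] at hs; omega)
    have hLx : ∀ y ∈ L, y ≠ x ∧ ¬ G.Adj x y := by
      intro y hy
      have := hL hy
      simp only [hB, Finset.mem_sdiff, Finset.mem_insert, Finset.mem_filter, not_or, not_and] at this
      exact ⟨this.2.1, this.2.2 this.1⟩
    refine ⟨insert x L, ?_, ?_, ?_⟩
    · exact Finset.insert_subset hx (hL.trans Finset.sdiff_subset)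
    · rw [Finset.card_insert_of_notMem fun h => (hLx x h).1 rfl, hLc]
    · intro y hy z hz
      rw [Finset.mem_insert] at hy hz
      rcases hy with rfl | hy <;> rcases hz with rfl | hz
      · exact G.irrefl
      · exact (hLx z hz).2
      · exact fun h => (hLx y hy).2 h.symm
      · exact hLi y hy z hz

-- The union bound over the three vertices of a prospective `P₃`; the surviving vertices supply the
-- isolated ones.
open Classical in
theorem card_le_card_filter_add (D : Finset V) (b : ℕ) (p q w : V)
    (h : ∀ z, z = p ∨ z = q ∨ z = w → (D.filter fun x => x = z ∨ G.Adj x z).card ≤ b) :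
    D.card ≤ (D.filter fun x => ∀ z, z = p ∨ z = q ∨ z = w → x ≠ z ∧ ¬ G.Adj x z).card + 3 * b := by
  have h1 := h p (by simp)
  have h2 := h q (by simp)
  have h3 := h w (by simp)
  have hsub : D ⊆ (D.filter fun x => ∀ z, z = p ∨ z = q ∨ z = w → x ≠ z ∧ ¬ G.Adj x z) ∪
      ((D.filter fun x => x = p ∨ G.Adj x p) ∪ ((D.filter fun x => x = q ∨ G.Adj x q) ∪
        (D.filter fun x => x = w ∨ G.Adj x w))) := by
    intro x hx
    simp only [Finset.mem_union, Finset.mem_filter, hx, true_and]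
    by_contra hcon
    push Not at hcon
    obtain ⟨⟨z, hz, hxz⟩, hp, hq, hw⟩ := hcon
    rcases hz with rfl | rfl | rfl
    · exact hp.2 (hxz hp.1)
    · exact hq.2 (hxz hq.1)
    · exact hw.2 (hxz hw.1)
  have := Finset.card_le_card hsub
  have u1 := Finset.card_union_le (D.filter fun x => ∀ z, z = p ∨ z = q ∨ z = w →
    x ≠ z ∧ ¬ G.Adj x z) ((D.filter fun x => x = p ∨ G.Adj x p) ∪
      ((D.filter fun x => x = q ∨ G.Adj x q) ∪ (D.filter fun x => x = w ∨ G.Adj x w)))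
  have u2 := Finset.card_union_le (D.filter fun x => x = p ∨ G.Adj x p)
      ((D.filter fun x => x = q ∨ G.Adj x q) ∪ (D.filter fun x => x = w ∨ G.Adj x w))
  have u3 := Finset.card_union_le (D.filter fun x => x = q ∨ G.Adj x q)
    (D.filter fun x => x = w ∨ G.Adj x w)
  omega

open Classical in
/-- A forest-like vertex set with many vertices of `T` is a disjoint union of cliques up to one
vertex. -/
theorem exists_center {s : ℕ} (hG : IsFreeOf (sP1P3 s) G) {F : V → Prop} (hF : NoTCycle G T F)
    (hcard : (s + 3) * (s + 3) ≤ (T.filter F).card) :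
    ∃ r, F r ∧ P3Free G (fun v => F v ∧ v ≠ r) ∧ ∃ L : Finset V, L.card = s ∧
      (∀ x ∈ L, x ∈ T ∧ F x ∧ x ≠ r) ∧ ∀ x ∈ L, ∀ y ∈ L, ¬ G.Adj x y := by
  -- If `r` has `s + 3` neighbours in `T ∩ F`, these are independent, as there is no `T`-triangle,
  -- and a vertex of `F - r` equals or touches at most one of them, as there is no four-cycle
  -- through `T`. So a `P₃` in `F - r` misses at least `s` of them.
  by_cases hstar : ∃ r, F r ∧ s + 3 ≤ ((T.filter F).filter (G.Adj r)).card
  · obtain ⟨r, hr, hdeg⟩ := hstar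
    set L := (T.filter F).filter (G.Adj r) with hL
    have hLm : ∀ x ∈ L, x ∈ T ∧ F x ∧ G.Adj r x := by
      intro x hx
      simp only [hL, Finset.mem_filter] at hx
      exact ⟨hx.1.1, hx.1.2, hx.2⟩
    have hLi : ∀ x ∈ L, ∀ y ∈ L, ¬ G.Adj x y := fun x hx y hy hxy =>
      hF.noTTriangle x y r (hLm x hx).2.1 (hLm y hy).2.1 hr hxy (hLm x hx).2.2.symm
        (hLm y hy).2.2.symm (hLm x hx).1
    refine ⟨r, hr, ?_, ?_⟩
    · intro p q w hp hq hw hpq hqw hpw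
      by_contra hadj
      have hbad : ∀ z, z = p ∨ z = q ∨ z = w →
          (L.filter fun x => x = z ∨ G.Adj x z).card ≤ 1 := by
        intro z hz
        have hzF : F z ∧ z ≠ r := by rcases hz with rfl | rfl | rfl <;> assumption
        rw [Finset.card_le_one]
        intro x hx y hy
        rw [Finset.mem_filter] at hx hy
        obtain ⟨hx, hxz⟩ := hx
        obtain ⟨hy, hyz⟩ := hy
        by_contra hxy
        rcases hxz with rfl | hxz
        · rcases hyz with rfl | hyz
          · exact hxy rfl
          · exact hLi y hy x hx hyz
        · rcases hyz with rfl | hyz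
          · exact hLi x hx y hy hxz
          · exact hF.not_adj_of_adj (hLm x hx).1 (hLm x hx).2.1 hr hzF.1 (hLm y hy).2.1
              hzF.2.symm (Ne.symm hxy) (hLm x hx).2.2.symm hxz (hLm y hy).2.2 hyz
      have hc := card_le_card_filter_add (G := G) L 1 p q w hbad
      refine not_isFreeOf (s := s)
        (L.filter fun x => ∀ z, z = p ∨ z = q ∨ z = w → x ≠ z ∧ ¬ G.Adj x z) (by omega)
        (fun x hx y hy => hLi x (Finset.filter_subset _ _ hx)
          y (Finset.filter_subset _ _ hy)) hpq hqw hpw hadj (fun x hx => ?_) hG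
      exact (Finset.mem_filter.1 hx).2
    · obtain ⟨L', hL', hc⟩ := Finset.exists_subset_card_eq (show s ≤ L.card by omega)
      refine ⟨L', hc, fun x hx => ?_, fun x hx y hy => hLi x (hL' hx) y (hL' hy)⟩
      obtain ⟨h1, h2, h3⟩ := hLm x (hL' hx)
      exact ⟨h1, h2, h3.ne'⟩
  -- Now degrees into `T ∩ F` are below `s + 3`. A `P₃` in `F` spoils at most `3(s + 3)` of its
  -- vertices, and the remaining `s(s + 3)` contain `s` independent ones. So `F` itself is
  -- `P₃`-free, and any `r` in `T ∩ F` serves.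
  · push Not at hstar
    set D := T.filter F with hD
    have hDm : ∀ x ∈ D, x ∈ T ∧ F x := fun x hx => Finset.mem_filter.1 hx
    have hsub : ∀ D' ⊆ D, ∀ x ∈ D', (D'.filter (G.Adj x)).card < s + 3 := fun D' hD' x hx =>
      (Finset.card_le_card (Finset.filter_subset_filter _ hD')).trans_lt
        (hstar x (hDm x (hD' hx)).2)
    have hP3 : P3Free G F := by
      intro p q w hp hq hw hpq hqw hpw
      by_contra hadj
      have hbad : ∀ z, z = p ∨ z = q ∨ z = w →
          (D.filter fun x => x = z ∨ G.Adj x z).card ≤ s + 3 := by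
        intro z hz
        have hzF : F z := by rcases hz with rfl | rfl | rfl <;> assumption
        have : (D.filter fun x => x = z ∨ G.Adj x z) ⊆ insert z (D.filter (G.Adj z)) := by
          intro x hx
          rw [Finset.mem_filter] at hx
          rcases hx.2 with rfl | h
          · simp
          · simp [hx.1, h.symm]
        exact (Finset.card_le_card this).trans ((Finset.card_insert_le _ _).trans (hstar z hzF))
      have hc := card_le_card_filter_add (G := G) D (s + 3) p q w hbad
      obtain ⟨L, hL, hLc, hLi⟩ := exists_indep_of_degree_lt (G := G) (c := s + 3) (by omega) s _
        (hsub _ (Finset.filter_subset _ _)) (by nlinarith [hc, hcard])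
      refine not_isFreeOf (s := s) L hLc.ge hLi hpq hqw hpw hadj (fun x hx => ?_) hG
      exact (Finset.mem_filter.1 (hL hx)).2
    obtain ⟨r, hr⟩ : D.Nonempty := Finset.card_pos.1 (by nlinarith)
    obtain ⟨L, hL, hLc, hLi⟩ := exists_indep_of_degree_lt (G := G) (c := s + 3) (by omega) s
      (D.erase r) (hsub _ (Finset.erase_subset _ _)) (by
        rw [Finset.card_erase_of_mem hr]
        have : s * (s + 3) + 1 ≤ (s + 3) * (s + 3) := by nlinarith
        omega)
    refine ⟨r, (hDm r hr).2, fun x y z hx hy hz => hP3 x y z hx.1 hy.1 hz.1, L, hLc,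
      fun x hx => ?_, hLi⟩
    have := Finset.mem_erase.1 (hL hx)
    exact ⟨(hDm x this.2).1, (hDm x this.2).2, this.1⟩

open Classical in
/-- The cliques that meet an independent set `L` of vertices of `T` are small. -/
theorem exists_closed_superset [Fintype V] {F : V → Prop} {r : V} (hF : NoTTriangle G T F)
    (hP3 : P3Free G fun v => F v ∧ v ≠ r) (L : Finset V)
    (hL : ∀ x ∈ L, x ∈ T ∧ F x ∧ x ≠ r) :
    ∃ W : Finset V, L ⊆ W ∧ W.card ≤ 2 * L.card ∧ (∀ x ∈ W, F x ∧ x ≠ r) ∧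
      ∀ x ∈ W, ∀ y, F y → y ≠ r → G.Adj x y → y ∈ W := by
  let N : V → Finset V := fun l => Finset.univ.filter fun x => (F x ∧ x ≠ r) ∧ G.Adj l x
  have hN : ∀ l x, x ∈ N l ↔ (F x ∧ x ≠ r) ∧ G.Adj l x := by simp [N]
  -- Two neighbours of `l` would lie in its clique and form a triangle with `l ∈ T`. So each clique
  -- meeting `L` has at most two vertices, whence the bound `2 * L.card`.
  have huniq : ∀ l ∈ L, ∀ x y, F x → x ≠ r → F y → y ≠ r → G.Adj l x → G.Adj l y → x = y := by
    intro l hl x y hx hxr hy hyr hlx hly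
    by_contra hxy
    exact hF l x y (hL l hl).2.1 hx hy hlx hly
      (hP3 x l y ⟨hx, hxr⟩ (hL l hl).2 ⟨hy, hyr⟩ hlx.symm hly hxy) (hL l hl).1
  have hNc : ∀ l ∈ L, (N l).card ≤ 1 := by
    intro l hl
    rw [Finset.card_le_one]
    intro x hx y hy
    rw [hN] at hx hy
    exact huniq l hl x y hx.1.1 hx.1.2 hy.1.1 hy.1.2 hx.2 hy.2
  refine ⟨L ∪ L.biUnion N, Finset.subset_union_left, ?_, ?_, ?_⟩
  · have h1 := Finset.card_union_le L (L.biUnion N)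
    have h2 := Finset.card_biUnion_le_card_mul L N 1 hNc
    omega
  · intro x hx
    rw [Finset.mem_union, Finset.mem_biUnion] at hx
    rcases hx with hx | ⟨l, _, hx⟩
    · exact (hL x hx).2
    · exact ((hN _ _).1 hx).1
  · intro x hx y hy hyr hxy
    rw [Finset.mem_union, Finset.mem_biUnion] at hx ⊢
    rcases hx with hx | ⟨l, hl, hx⟩
    · exact .inr ⟨x, hx, (hN _ _).2 ⟨⟨hy, hyr⟩, hxy⟩⟩
    · obtain ⟨⟨hx, hxr⟩, hlx⟩ := (hN _ _).1 hx
      left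
      by_cases hly : l = y
      · exact hly ▸ hl
      · exact absurd (huniq l hl x y hx hxr hy hyr hlx
          (hP3 l x y (hL l hl).2 ⟨hx, hxr⟩ ⟨hy, hyr⟩ hlx hxy hly)) hxy.ne

end Structure

/-! ### The choice in the cliques of free vertices -/

section Selection

variable {V : Type*} (G : SimpleGraph V) (T : Finset V) {m : ℕ} (r : V)
  (w : Fin m → V)

/-- The vertices that are not touched by the guess `r, w`. -/
def Free (v : V) : Prop := v ≠ r ∧ ∀ j, v ≠ w j ∧ ¬ G.Adj v (w j)

/-- The relation of lying in the same clique. -/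
def Sim (u v : V) : Prop := u = v ∨ G.Adj u v

variable {G} in
theorem Sim.symm {u v : V} (h : Sim G u v) : Sim G v u := h.imp Eq.symm G.adj_symm

/-- The free vertices `a` and `b` are adjacent and do not form a triangle with `r` that
meets `T`. -/
def Pair (a b : V) : Prop :=
  Free G r w a ∧ Free G r w b ∧ G.Adj a b ∧
    ¬ (G.Adj a r ∧ G.Adj b r ∧ (a ∈ T ∨ b ∈ T ∨ r ∈ T))

variable [LinearOrder V]

/-- The free vertices outside `T`, but only the first neighbour of `r` in each clique if
`r ∈ T`. -/
def Main (v : V) : Prop :=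
  Free G r w v ∧ v ∉ T ∧ (r ∈ T → G.Adj v r →
    ∀ u, Free G r w u → u ∉ T → G.Adj u r → Sim G u v → v ≤ u)

/-- The clique of `v` has at least two main vertices. -/
def Big (v : V) : Prop :=
  ∃ a b, Main G T r w a ∧ Main G T r w b ∧ a ≠ b ∧ Sim G a v ∧ Sim G b v

/-- The pair `(a, b)` is the first one of its clique. -/
def First (a b : V) : Prop :=
  Pair G T r w a b ∧ ∀ a' b', Pair G T r w a' b' → Sim G a' a → a < a' ∨ (a = a' ∧ b ≤ b')

/-- An optimal choice of free vertices in each clique. -/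
def Sel (v : V) : Prop :=
  Free G r w v ∧ ((Big G T r w v ∧ Main G T r w v) ∨
    (¬ Big G T r w v ∧ ∃ u, First G T r w v u ∨ First G T r w u v) ∨
    (¬ Big G T r w v ∧ (∀ a b, Pair G T r w a b → ¬ Sim G a v) ∧
      ∀ u, Free G r w u → Sim G u v → v ≤ u))

/-- The vertices that are kept for the guess `r, w`. -/
def Kept (v : V) : Prop := v = r ∨ (∃ j, v = w j) ∨ Sel G T r w v

variable {G T r w}

theorem First.unique {a b a' b' : V} (h : First G T r w a b) (h' : First G T r w a' b')
    (hs : Sim G a' a) : a = a' ∧ b = b' := by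
  have h1 := h.2 a' b' h'.1 hs
  have h2 := h'.2 a b h.1 hs.symm
  rcases h1 with h1 | ⟨rfl, h1⟩
  · rcases h2 with h2 | ⟨rfl, h2⟩
    · exact absurd h1 h2.not_gt
    · exact absurd h1 (lt_irrefl _)
  · rcases h2 with h2 | ⟨_, h2⟩
    · exact absurd h2 (lt_irrefl _)
    · exact ⟨rfl, le_antisymm h1 h2⟩

section

variable (hC : P3Free G (Free G r w))
include hC

theorem Sim.trans' {a b c : V} (ha : Free G r w a) (hb : Free G r w b) (hc : Free G r w c)
    (h : Sim G a b) (h' : Sim G b c) : Sim G a c := by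
  rcases h with rfl | h
  · exact h'
  · rcases h' with rfl | h'
    · exact .inr h
    · by_cases hac : a = c
      · exact .inl hac
      · exact .inr (hC a b c ha hb hc h h' hac)

theorem Big.congr {u v : V} (hu : Free G r w u) (hv : Free G r w v) (h : Sim G u v)
    (hb : Big G T r w u) : Big G T r w v := by
  obtain ⟨a, b, ha, hb, hab, hau, hbu⟩ := hb
  exact ⟨a, b, ha, hb, hab, hau.trans' hC ha.1 hu hv h, hbu.trans' hC hb.1 hu hv h⟩

/-- Adjacent free vertices share a clique, and the clique alone decides which of the three rules in
`Sel` applies. The third rule selects a single vertex, so it cannot produce an edge. -/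
theorem Sel.adj {p q : V} (hp : Sel G T r w p) (hq : Sel G T r w q) (h : G.Adj p q) :
    (Main G T r w p ∧ Main G T r w q) ∨ First G T r w p q ∨ First G T r w q p := by
  obtain ⟨hpF, hp⟩ := hp
  obtain ⟨hqF, hq⟩ := hq
  have hpq : Sim G p q := .inr h
  by_cases hb : Big G T r w p
  · have hb' := hb.congr hC hpF hqF hpq
    left
    simp only [hb, hb', not_true_eq_false, false_and, or_false, true_and] at hp hq
    exact ⟨hp, hq⟩
  · have hb' : ¬ Big G T r w q := fun h => hb (h.congr hC hqF hpF hpq.symm)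
    right
    simp only [hb, hb', not_false_eq_true, false_and, false_or, true_and] at hp hq
    have simF : ∀ {a b : V}, First G T r w a b → Sim G b a := fun h => .inr h.1.2.2.1.symm
    rcases hp with ⟨u, hp⟩ | ⟨hp, hpl⟩
    · rcases hq with ⟨u', hq⟩ | ⟨hq, _⟩
      · rcases hp with hp | hp <;> rcases hq with hq | hq
        · obtain ⟨rfl, _⟩ := hp.unique hq hpq.symm
          exact absurd h G.irrefl
        · obtain ⟨rfl, rfl⟩ := hp.unique hq
            ((simF hq).symm.trans' hC hq.1.1 hqF hpF hpq.symm)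
          exact .inl hp
        · obtain ⟨rfl, rfl⟩ := hp.unique hq (hpq.symm.trans' hC hqF hpF hp.1.1 (simF hp))
          exact .inr hp
        · obtain ⟨_, rfl⟩ := hp.unique hq
            ((simF hq).symm.trans' hC hq.1.1 hqF hp.1.1 (hpq.symm.trans' hC hqF hpF hp.1.1 (simF hp)))
          exact absurd h G.irrefl
      · rcases hp with hp | hp
        · exact absurd hpq (hq _ _ hp.1)
        · exact absurd ((simF hp).symm.trans' hC hp.1.1 hpF hqF hpq) (hq _ _ hp.1)
    · rcases hq with ⟨u', hq⟩ | ⟨_, hql⟩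
      · rcases hq with hq | hq
        · exact absurd hpq.symm (hp _ _ hq.1)
        · exact absurd ((simF hq).symm.trans' hC hq.1.1 hqF hpF hpq.symm) (hp _ _ hq.1)
      · exact absurd (le_antisymm (hpl q hqF hpq.symm) (hql p hpF hpq)) h.ne

/-- Main vertices lie outside `T`, and if `r ∈ T` only one neighbour of `r` per clique is main. For
a chosen pair the claim is built into `Pair`. -/
theorem Sel.not_mem_of_triangle {p q : V} (hp : Sel G T r w p) (hq : Sel G T r w q)
    (h : G.Adj p q) (hpr : G.Adj p r) (hqr : G.Adj q r) : p ∉ T ∧ q ∉ T ∧ r ∉ T := by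
  rcases hp.adj hC hq h with ⟨h1, h2⟩ | h1 | h1
  · refine ⟨h1.2.1, h2.2.1, fun hr => ?_⟩
    exact h.ne (le_antisymm (h1.2.2 hr hpr q h2.1 h2.2.1 hqr (.inr h.symm))
      (h2.2.2 hr hqr p h1.1 h1.2.1 hpr (.inr h)))
  · have := h1.1.2.2.2
    tauto
  · have := h1.1.2.2.2
    tauto

/-- A clique treated by the pair rule has only two selected vertices, so a triangle consists of main
vertices. -/
theorem Sel.not_mem_of_triangle' {p q u : V} (hp : Sel G T r w p) (hq : Sel G T r w q)
    (hu : Sel G T r w u) (hpq : G.Adj p q) (hpu : G.Adj p u) (hqu : G.Adj q u) : p ∉ T := by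
  rcases hp.adj hC hq hpq with ⟨h1, _⟩ | h1 | h1
  · exact h1.2.1
  · rcases hp.adj hC hu hpu with ⟨h2, _⟩ | h2 | h2
    · exact h2.2.1
    · exact absurd (h1.unique h2 (.inl rfl)).2 hqu.ne
    · exact absurd (h1.unique h2 (.inr hpu.symm)).1 hpu.ne
  · rcases hp.adj hC hu hpu with ⟨h2, _⟩ | h2 | h2
    · exact h2.2.1
    · exact absurd (h1.unique h2 (.inr hpq)).1 hpq.ne'
    · exact absurd (h1.unique h2 (.inr hqu.symm)).1 hqu.ne

/-- No edge joins a guessed vertex `w j` to a selected one, so a `P₃` lies entirely among the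
former, inside `F - r`, or among the free vertices. -/
theorem p3Free_kept {F : V → Prop} (hw : ∀ j, F (w j) ∧ w j ≠ r)
    (hF : P3Free G fun v => F v ∧ v ≠ r) : P3Free G fun v => Kept G T r w v ∧ v ≠ r := by
  have hsep : ∀ {x y : V}, G.Adj x y → (∃ j, x = w j) → ¬ Sel G T r w y := by
    rintro x y h ⟨j, rfl⟩ hy
    exact (hy.1.2 j).2 h.symm
  rintro x y z ⟨hx, hxr⟩ ⟨hy, hyr⟩ ⟨hz, hzr⟩ hxy hyz hxz
  replace hx := hx.resolve_left hxr
  replace hy := hy.resolve_left hyr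
  replace hz := hz.resolve_left hzr
  rcases hy with hy | hy
  · obtain ⟨i, rfl⟩ := hx.resolve_right (hsep hxy.symm hy)
    obtain ⟨k, rfl⟩ := hz.resolve_right (hsep hyz hy)
    obtain ⟨j, rfl⟩ := hy
    exact hF _ _ _ (hw i) (hw j) (hw k) hxy hyz hxz
  · have hx := hx.resolve_left fun h => hsep hxy h hy
    have hz := hz.resolve_left fun h => hsep hyz.symm h hy
    exact hC x y z hx.1 hy.1 hz.1 hxy hyz hxz

/-- A triangle through some `w j` has its other vertices among `r` and the guessed ones, hence lies
in `F`. All others consist of selected vertices and possibly `r`. -/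
theorem noTTriangle_kept {F : V → Prop} (hr : F r) (hw : ∀ j, F (w j))
    (hF : NoTTriangle G T F) : NoTTriangle G T (Kept G T r w) := by
  have hsep : ∀ {x y : V}, G.Adj x y → (∃ j, x = w j) → Kept G T r w y → F y := by
    rintro x y h ⟨j, rfl⟩ (rfl | ⟨i, rfl⟩ | hy)
    · exact hr
    · exact hw i
    · exact absurd h.symm (hy.1.2 j).2
  intro x y z hx hy hz hxy hxz hyz hT
  have hall : ∀ {p q u : V}, Kept G T r w q → Kept G T r w u → G.Adj p q → G.Adj p u →
      (∃ j, p = w j) → F p ∧ F q ∧ F u := by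
    intro p q u hq hu hpq hpu hp
    refine ⟨?_, hsep hpq hp hq, hsep hpu hp hu⟩
    obtain ⟨j, rfl⟩ := hp
    exact hw j
  by_cases hx1 : ∃ j, x = w j
  · obtain ⟨h1, h2, h3⟩ := hall hy hz hxy hxz hx1
    exact hF x y z h1 h2 h3 hxy hxz hyz hT
  by_cases hy1 : ∃ j, y = w j
  · obtain ⟨h1, h2, h3⟩ := hall hx hz hxy.symm hyz hy1
    exact hF x y z h2 h1 h3 hxy hxz hyz hT
  by_cases hz1 : ∃ j, z = w j
  · obtain ⟨h1, h2, h3⟩ := hall hx hy hxz.symm hyz.symm hz1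
    exact hF x y z h2 h3 h1 hxy hxz hyz hT
  simp only [Kept, hx1, hy1, hz1, false_or] at hx hy hz
  rcases hx with rfl | hx
  · have hy := hy.resolve_left hxy.ne'
    have hz := hz.resolve_left hxz.ne'
    exact (hy.not_mem_of_triangle hC hz hyz hxy.symm hxz.symm).2.2 hT
  · rcases hy with rfl | hy
    · have hz := hz.resolve_left hyz.ne'
      exact (hx.not_mem_of_triangle hC hz hxz hxy hyz.symm).1 hT
    · rcases hz with rfl | hz
      · exact (hx.not_mem_of_triangle hC hy hxy hxz hyz).1 hT
      · exact hx.not_mem_of_triangle' hC hy hz hxy hxz hyz hT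

end

end Selection


/-! ### Optimality of the choice -/

section Counting

variable {V : Type*} {G : SimpleGraph V} {T : Finset V} {m : ℕ} {r : V} {w : Fin m → V}
  [LinearOrder V] [Fintype V]

open Classical in
theorem exists_first {a b c : V} (hC : P3Free G (Free G r w)) (hc : Free G r w c)
    (h : Pair G T r w a b) (hac : Sim G a c) :
    ∃ a b, First G T r w a b ∧ Sim G a c ∧ Sim G b c := by
  let P : Finset (V × V) := Finset.univ.filter fun p => Pair G T r w p.1 p.2 ∧ Sim G p.1 c
  have hP : ∀ p, p ∈ P ↔ Pair G T r w p.1 p.2 ∧ Sim G p.1 c := by simp [P]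
  obtain ⟨⟨x, y⟩, hxy, hmin⟩ := Finset.exists_min_image P toLex ⟨(a, b), (hP _).2 ⟨h, hac⟩⟩
  rw [hP] at hxy
  refine ⟨x, y, ⟨hxy.1, fun a' b' h' hs => ?_⟩, hxy.2, ?_⟩
  · have := hmin (a', b') ((hP _).2 ⟨h', hs.trans' hC h'.1 hxy.1.1 hc hxy.2⟩)
    rwa [Prod.Lex.toLex_le_toLex] at this
  · exact Sim.trans' hC hxy.1.2.1 hxy.1.1 hc (.inr hxy.1.2.2.1.symm) hxy.2

theorem exists_first_free {p : V → Prop} {a : V} (hp : p a) : ∃ a, p a ∧ ∀ b, p b → a ≤ b := by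
  classical
  obtain ⟨x, hx, hmin⟩ := Finset.exists_min_image (Finset.univ.filter p) id ⟨a, by simpa using hp⟩
  exact ⟨x, by simpa using hx, fun b hb => hmin b (by simpa using hb)⟩

-- Three vertices of `F` in one clique prevent any vertex of `F` there from lying in `T`. If `r ∈
-- T`, at most one of them, `q`, is adjacent to `r`; exchanging `q` for the first eligible neighbour
-- `q₀` of `r` maps them into the main vertices. Otherwise they are all main already.
open Classical in
theorem card_filter_le_card_main {F : V → Prop} (hC : P3Free G (Free G r w)) (hr : F r)
    (htri : NoTTriangle G T F) {c : V} (hc : Free G r w c)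
    (h3 : 3 ≤ (Finset.univ.filter fun v => F v ∧ Free G r w v ∧ Sim G v c).card) :
    (Finset.univ.filter fun v => F v ∧ Free G r w v ∧ Sim G v c).card ≤
      (Finset.univ.filter fun v => Main G T r w v ∧ Sim G v c).card := by
  set FQ := Finset.univ.filter fun v => F v ∧ Free G r w v ∧ Sim G v c with hFQ
  have hm : ∀ v, v ∈ FQ ↔ F v ∧ Free G r w v ∧ Sim G v c := by simp [hFQ]
  have hadj : ∀ x ∈ FQ, ∀ y ∈ FQ, x ≠ y → G.Adj x y := by
    intro x hx y hy hxy
    rw [hm] at hx hy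
    exact (hx.2.2.trans' hC hx.2.1 hc hy.2.1 hy.2.2.symm).resolve_left hxy
  have hT : ∀ x ∈ FQ, x ∉ T := by
    intro x hx
    have : 1 < (FQ.erase x).card := by rw [Finset.card_erase_of_mem hx]; omega
    obtain ⟨y, hy, z, hz, hyz⟩ := Finset.one_lt_card.1 this
    rw [Finset.mem_erase] at hy hz
    exact htri x y z ((hm x).1 hx).1 ((hm y).1 hy.2).1 ((hm z).1 hz.2).1 (hadj x hx y hy.2 hy.1.symm)
      (hadj x hx z hz.2 hz.1.symm) (hadj y hy.2 z hz.2 hyz)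
  by_cases hq : ∃ q ∈ FQ, r ∈ T ∧ G.Adj q r
  · obtain ⟨q, hq, hrT, hqr⟩ := hq
    obtain ⟨q₀, ⟨h1, h2, h3, h4⟩, hmin⟩ := exists_first_free
      (p := fun u => Free G r w u ∧ u ∉ T ∧ G.Adj u r ∧ Sim G u c)
      ⟨((hm q).1 hq).2.1, hT q hq, hqr, ((hm q).1 hq).2.2⟩
    have hq₀ : q₀ ∈ Finset.univ.filter fun v => Main G T r w v ∧ Sim G v c := by
      rw [Finset.mem_filter]
      refine ⟨Finset.mem_univ _, ⟨h1, h2, fun _ _ u hu huT hur hus => ?_⟩, h4⟩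
      exact hmin u ⟨hu, huT, hur, hus.trans' hC hu h1 hc h4⟩
    have hsub : FQ.erase q ⊆
        (Finset.univ.filter fun v => Main G T r w v ∧ Sim G v c).erase q₀ := by
      intro v hv
      rw [Finset.mem_erase] at hv
      have hvr : ¬ G.Adj v r := fun hvr =>
        htri r q v hr ((hm q).1 hq).1 ((hm v).1 hv.2).1 hqr.symm hvr.symm
          (hadj q hq v hv.2 hv.1.symm) hrT
      rw [Finset.mem_erase, Finset.mem_filter]
      refine ⟨fun h => hvr (h ▸ h3), Finset.mem_univ _, ⟨((hm v).1 hv.2).2.1, hT v hv.2,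
        fun _ h => absurd h hvr⟩, ((hm v).1 hv.2).2.2⟩
    have := Finset.card_le_card hsub
    rw [Finset.card_erase_of_mem hq, Finset.card_erase_of_mem hq₀] at this
    have := Finset.card_pos.2 ⟨q₀, hq₀⟩
    omega
  · refine Finset.card_le_card fun v hv => ?_
    rw [Finset.mem_filter]
    exact ⟨Finset.mem_univ _, ⟨((hm v).1 hv).2.1, hT v hv, fun hrT hvr =>
      absurd ⟨v, hv, hrT, hvr⟩ hq⟩, ((hm v).1 hv).2.2⟩

-- In a big clique at least two main vertices are selected, and three vertices of `F` are handled by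
-- `card_filter_le_card_main`. That lemma also shows that `F` has at most two vertices in a clique
-- that is not big. If it has two, they form a `Pair`, so the pair rule selects two; if it has at
-- most one, some vertex is selected in any case.
open Classical in
theorem card_filter_le_card_sel {F : V → Prop} (hC : P3Free G (Free G r w)) (hr : F r)
    (htri : NoTTriangle G T F) {c : V} (hc : Free G r w c) :
    (Finset.univ.filter fun v => F v ∧ Free G r w v ∧ Sim G v c).card ≤
      (Finset.univ.filter fun v => Sel G T r w v ∧ Sim G v c).card := by
  have hcc : Sim G c c := .inl rfl
  by_cases hb : Big G T r w c
  · have hsub : (Finset.univ.filter fun v => Main G T r w v ∧ Sim G v c) ⊆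
        Finset.univ.filter fun v => Sel G T r w v ∧ Sim G v c := by
      intro v hv
      rw [Finset.mem_filter] at hv ⊢
      exact ⟨hv.1, ⟨hv.2.1.1, .inl ⟨hb.congr hC hc hv.2.1.1 hv.2.2.symm, hv.2.1⟩⟩, hv.2.2⟩
    refine le_trans ?_ (Finset.card_le_card hsub)
    by_cases h3 : 3 ≤ (Finset.univ.filter fun v => F v ∧ Free G r w v ∧ Sim G v c).card
    · exact card_filter_le_card_main hC hr htri hc h3
    · obtain ⟨a, b, ha, hb, hab, hac, hbc⟩ := hb
      have : 1 < (Finset.univ.filter fun v => Main G T r w v ∧ Sim G v c).card :=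
        Finset.one_lt_card.2 ⟨a, by simp [ha, hac], b, by simp [hb, hbc], hab⟩
      omega
  · have h2 : (Finset.univ.filter fun v => F v ∧ Free G r w v ∧ Sim G v c).card ≤ 2 := by
      by_contra h3
      have := card_filter_le_card_main hC hr htri hc (by omega)
      obtain ⟨a, ha, b, hb', hab⟩ := Finset.one_lt_card.1 (show 1 < (Finset.univ.filter fun v =>
        Main G T r w v ∧ Sim G v c).card by omega)
      rw [Finset.mem_filter] at ha hb'
      exact hb ⟨a, b, ha.2.1, hb'.2.1, hab, ha.2.2, hb'.2.2⟩
    have hnb : ∀ {v}, Free G r w v → Sim G v c → ¬ Big G T r w v := fun hv hvc h =>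
      hb (h.congr hC hv hc hvc)
    by_cases hp : ∃ a b, Pair G T r w a b ∧ Sim G a c
    · obtain ⟨a, b, hab, hac⟩ := hp
      obtain ⟨x, y, hxy, hxc, hyc⟩ := exists_first hC hc hab hac
      have hx : Sel G T r w x := ⟨hxy.1.1, .inr (.inl ⟨hnb hxy.1.1 hxc, y, .inl hxy⟩)⟩
      have hy : Sel G T r w y := ⟨hxy.1.2.1, .inr (.inl ⟨hnb hxy.1.2.1 hyc, x, .inr hxy⟩)⟩
      have : 1 < (Finset.univ.filter fun v => Sel G T r w v ∧ Sim G v c).card :=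
        Finset.one_lt_card.2 ⟨x, by simp [hx, hxc], y, by simp [hy, hyc], hxy.1.2.2.1.ne⟩
      omega
    · have h1 : (Finset.univ.filter fun v => F v ∧ Free G r w v ∧ Sim G v c).card ≤ 1 := by
        rw [Finset.card_le_one]
        intro x hx y hy
        rw [Finset.mem_filter] at hx hy
        by_contra hne
        obtain ⟨_, hxF, hx, hxc⟩ := hx
        obtain ⟨_, hyF, hy, hyc⟩ := hy
        have hxy := (hxc.trans' hC hx hc hy hyc.symm).resolve_left hne
        refine hp ⟨x, y, ⟨hx, hy, hxy, ?_⟩, hxc⟩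
        rintro ⟨hxr, hyr, h | h | h⟩
        · exact htri x y r hxF hyF hr hxy hxr hyr h
        · exact htri y x r hyF hxF hr hxy.symm hyr hxr h
        · exact htri r x y hr hxF hyF hxr.symm hyr.symm hxy h
      obtain ⟨x, ⟨hx, hxc⟩, hmin⟩ := exists_first_free
        (p := fun u => Free G r w u ∧ Sim G u c) ⟨hc, hcc⟩
      have hsel : Sel G T r w x := ⟨hx, .inr (.inr ⟨hnb hx hxc, fun a b hab hax =>
        hp ⟨a, b, hab, hax.trans' hC hab.1 hx hc hxc⟩, fun u hu hux =>
          hmin u ⟨hu, hux.trans' hC hu hx hc hxc⟩⟩)⟩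
      have : 0 < (Finset.univ.filter fun v => Sel G T r w v ∧ Sim G v c).card :=
        Finset.card_pos.2 ⟨x, by simp [hsel, hxc]⟩
      omega

-- The estimate is summed over the cliques; the map `f`, sending a vertex to its clique as a set,
-- provides the fibres.
open Classical in
theorem card_free_le_card_sel {F : V → Prop} (hC : P3Free G (Free G r w)) (hr : F r)
    (htri : NoTTriangle G T F) :
    (Finset.univ.filter fun v => F v ∧ Free G r w v).card ≤
      (Finset.univ.filter (Sel G T r w)).card := by
  let f : V → Set V := fun v => {u | Free G r w u ∧ Sim G u v}
  have hf : ∀ {u v : V}, Free G r w u → Free G r w v → (f u = f v ↔ Sim G u v) := by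
    intro u v hu hv
    constructor
    · intro h
      have : u ∈ f u := ⟨hu, .inl rfl⟩
      rw [h] at this
      exact this.2
    · intro h
      ext x
      exact ⟨fun hx => ⟨hx.1, hx.2.trans' hC hx.1 hu hv h⟩,
        fun hx => ⟨hx.1, hx.2.trans' hC hx.1 hv hu h.symm⟩⟩
  let t := (Finset.univ.filter (Free G r w)).image f
  rw [Finset.card_eq_sum_card_fiberwise (f := f) (t := t), Finset.card_eq_sum_card_fiberwise
    (f := f) (t := t)]
  · refine Finset.sum_le_sum fun b hb => ?_
    simp only [t, Finset.mem_image, Finset.mem_filter, Finset.mem_univ, true_and] at hb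
    obtain ⟨c, hc, rfl⟩ := hb
    have := card_filter_le_card_sel hC hr htri hc
    rw [Finset.filter_filter, Finset.filter_filter]
    have e1 : ∀ v, ((F v ∧ Free G r w v) ∧ f v = f c) ↔ F v ∧ Free G r w v ∧ Sim G v c :=
      fun v => ⟨fun h => ⟨h.1.1, h.1.2, (hf h.1.2 hc).1 h.2⟩,
        fun h => ⟨⟨h.1, h.2.1⟩, (hf h.2.1 hc).2 h.2.2⟩⟩
    have e2 : ∀ v, (Sel G T r w v ∧ f v = f c) ↔ Sel G T r w v ∧ Sim G v c :=
      fun v => ⟨fun h => ⟨h.1, (hf h.1.1 hc).1 h.2⟩, fun h => ⟨h.1, (hf h.1.1 hc).2 h.2⟩⟩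
    simpa only [e1, e2] using this
  · intro v hv
    have hv' : Sel G T r w v := by simpa using hv
    simp only [t, Finset.coe_image]
    exact ⟨v, by simpa using hv'.1, rfl⟩
  · intro v hv
    have hv' : F v ∧ Free G r w v := by simpa using hv
    simp only [t, Finset.coe_image]
    exact ⟨v, by simpa using hv'.2, rfl⟩

-- The vertices `r` and `w j` are kept on both sides and are disjoint from the free ones, so only
-- the free parts need comparison.
open Classical in
theorem ncard_not_kept_le {F : V → Prop} (hC : P3Free G (Free G r w)) (hr : F r)
    (htri : NoTTriangle G T F) (hcov : ∀ v, F v → v = r ∨ (∃ j, v = w j) ∨ Free G r w v) :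
    {v | ¬ Kept G T r w v}.ncard ≤ {v | ¬ F v}.ncard := by
  have key : (Finset.univ.filter F).card ≤ (Finset.univ.filter (Kept G T r w)).card := by
    have h := card_free_le_card_sel hC hr htri
    set B := Finset.univ.filter fun v => v = r ∨ ∃ j, v = w j with hB
    have h1 : (Finset.univ.filter F) ⊆ B ∪ Finset.univ.filter fun v => F v ∧ Free G r w v := by
      intro v hv
      simp only [hB, Finset.mem_union, Finset.mem_filter, Finset.mem_univ, true_and] at hv ⊢
      have := hcov v hv
      tauto
    have h2 : B ∪ Finset.univ.filter (Sel G T r w) ⊆ Finset.univ.filter (Kept G T r w) := by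
      intro v hv
      simp only [hB, Finset.mem_union, Finset.mem_filter, Finset.mem_univ, true_and, Kept] at hv ⊢
      tauto
    have h3 : Disjoint B (Finset.univ.filter (Sel G T r w)) := by
      rw [Finset.disjoint_left]
      intro v hv hs
      simp only [hB, Finset.mem_filter, Finset.mem_univ, true_and] at hv hs
      rcases hv with hv | ⟨j, hj⟩
      · exact hs.1.1 hv
      · exact (hs.1.2 j).1 hj
    have h4 := Finset.card_le_card h1
    have h5 := Finset.card_le_card h2
    rw [Finset.card_union_of_disjoint h3] at h5
    have h6 := Finset.card_union_le B (Finset.univ.filter fun v => F v ∧ Free G r w v)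
    omega
  have compl : ∀ P : V → Prop, {v | ¬ P v}.ncard = Fintype.card V - (Finset.univ.filter P).card := by
    intro P
    rw [Set.ncard_eq_toFinset_card', ← Finset.card_compl]
    congr 1
    ext v
    simp
  rw [compl, compl]
  omega

end Counting


/-! ### Definability -/

open Relation

/-- A property of an instance and a family of its vertices that is expressed by a formula. -/
def Definable {ι : Type} (P : ∀ I : SFVSInstance, (ι → Fin I.n) → Prop) : Prop :=
  ∃ φ : Formula ι, ∀ I e, φ.Holds I e ↔ P I e

namespace Definable

variable {ι : Type}

theorem memT (i : ι) : Definable fun I e => e i ∈ I.T := ⟨.memT i, fun _ _ => Iff.rfl⟩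

theorem adj (i j : ι) : Definable fun I e => I.G.Adj (e i) (e j) := ⟨.adj i j, fun _ _ => Iff.rfl⟩

theorem lt (i j : ι) : Definable fun _ e => e i < e j := ⟨.lt i j, fun _ _ => Iff.rfl⟩

section

variable {P Q : ∀ I : SFVSInstance, (ι → Fin I.n) → Prop}

theorem congr (hP : Definable P) (h : ∀ I e, P I e ↔ Q I e) : Definable Q :=
  hP.imp fun _ hφ I e => (hφ I e).trans (h I e)

theorem not (hP : Definable P) : Definable fun I e => ¬ P I e := by
  obtain ⟨φ, hφ⟩ := hP
  exact ⟨.not φ, fun I e => not_congr (hφ I e)⟩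

theorem and (hP : Definable P) (hQ : Definable Q) : Definable fun I e => P I e ∧ Q I e := by
  obtain ⟨φ, hφ⟩ := hP
  obtain ⟨ψ, hψ⟩ := hQ
  exact ⟨.and φ ψ, fun I e => and_congr (hφ I e) (hψ I e)⟩

theorem or (hP : Definable P) (hQ : Definable Q) : Definable fun I e => P I e ∨ Q I e :=
  (hP.not.and hQ.not).not.congr fun I e => by tauto

theorem imp (hP : Definable P) (hQ : Definable Q) : Definable fun I e => P I e → Q I e :=
  (hP.and hQ.not).not.congr fun I e => by tauto

end

theorem le (i j : ι) : Definable fun _ e => e i ≤ e j :=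
  (lt j i).not.congr fun _ _ => not_lt

theorem eq (i j : ι) : Definable fun _ e => e i = e j :=
  ((le i j).and (le j i)).congr fun _ _ => le_antisymm_iff.symm

theorem ne (i j : ι) : Definable fun _ e => e i ≠ e j := (eq i j).not

section

variable {P : ∀ I : SFVSInstance, (ι → Fin I.n) → Fin I.n → Prop}

theorem ex (hP : Definable (ι := Option ι) fun I e => P I (fun i => e (some i)) (e none)) :
    Definable fun I e => ∃ a, P I e a := by
  obtain ⟨φ, hφ⟩ := hP
  exact ⟨.ex φ, fun I e => exists_congr fun a => hφ I fun o => o.elim a e⟩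

theorem all (hP : Definable (ι := Option ι) fun I e => P I (fun i => e (some i)) (e none)) :
    Definable fun I e => ∀ a, P I e a :=
  (ex (P := fun I e a => ¬ P I e a) hP.not).not.congr fun I e => by simp

theorem few (hP : Definable (ι := Option ι) fun I e => P I (fun i => e (some i)) (e none)) :
    Definable fun I e => {a | P I e a}.ncard ≤ I.k := by
  obtain ⟨φ, hφ⟩ := hP
  refine ⟨.few φ, fun I e => ?_⟩
  have : {a | φ.Holds I fun o => o.elim a e} = {a | P I e a} :=
    Set.ext fun a => hφ I fun o => o.elim a e
  change {a | φ.Holds I fun o => o.elim a e}.ncard ≤ I.k ↔ _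
  rw [this]

end

theorem false : Definable (ι := ι) fun _ _ => False :=
  (ex (P := fun _ _ a => a < a) (lt none none)).congr fun I e => by simp

theorem exFin {m : ℕ} {P : Fin m → ∀ I : SFVSInstance, (ι → Fin I.n) → Prop}
    (hP : ∀ j, Definable (P j)) : Definable fun I e => ∃ j, P j I e := by
  induction m with
  | zero => exact false.congr fun I e => by simp
  | succ m ih =>
    exact ((hP 0).or (ih fun j => hP j.succ)).congr fun I e =>
      (Fin.exists_fin_succ (P := fun j => P j I e)).symm

theorem allFin {m : ℕ} {P : Fin m → ∀ I : SFVSInstance, (ι → Fin I.n) → Prop}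
    (hP : ∀ j, Definable (P j)) : Definable fun I e => ∀ j, P j I e :=
  (exFin (P := fun j I e => ¬ P j I e) fun j => (hP j).not).not.congr fun I e => by simp

theorem exLe {c : ℕ} {P : ℕ → ∀ I : SFVSInstance, (ι → Fin I.n) → Prop}
    (hP : ∀ m, Definable (P m)) : Definable fun I e => ∃ m ≤ c, P m I e :=
  (exFin (m := c + 1) (P := fun j => P j) fun j => hP j).congr fun _ _ =>
    ⟨fun ⟨j, hj⟩ => ⟨j, Nat.le_of_lt_succ j.2, hj⟩,
      fun ⟨m, hm, h⟩ => ⟨⟨m, Nat.lt_succ_of_le hm⟩, h⟩⟩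

/-- Each entry of the tuple is one more quantifier and enlarges the index type. The hypothesis is
therefore required under every renaming `ρ` of the variables, so that it survives the induction. -/
theorem exTuple {m : ℕ} {P : ∀ I : SFVSInstance, (ι → Fin I.n) → (Fin m → Fin I.n) → Prop}
    (hP : ∀ {κ : Type} (ρ : ι → κ) (w : Fin m → κ),
      Definable fun I e => P I (fun i => e (ρ i)) fun j => e (w j)) :
    Definable fun I e => ∃ w, P I e w := by
  induction m generalizing ι with
  | zero =>
    refine (hP id Fin.elim0).congr fun I e => ⟨fun h => ⟨_, h⟩, fun ⟨w, h⟩ => ?_⟩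
    rwa [Subsingleton.elim w fun j => e (Fin.elim0 j)] at h
  | succ m ih =>
    refine (ex (P := fun I e a => ∃ w, P I e (Fin.cons a w)) (ih
      (P := fun I e w => P I (fun i => e (some i)) (Fin.cons (e none) w)) fun {κ} ρ w => ?_)).congr
      fun I e => (Fin.exists_fin_succ_pi (P := P I e)).symm
    refine (hP (fun i => ρ (some i)) (Fin.cons (ρ none) w)).congr fun I e => ?_
    rw [show (fun j => e ((Fin.cons (ρ none) w : Fin (m + 1) → κ) j)) =
      Fin.cons (e (ρ none)) fun j => e (w j) from funext fun j => by cases j using Fin.cases <;> rfl]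

variable {m : ℕ}

/-- For a fixed length the recursion unfolds into `d` nested existential quantifiers. -/
theorem reach {F : ∀ I : SFVSInstance, (ι → Fin I.n) → Fin I.n → Prop} (d : ℕ)
    (hF : ∀ {κ : Type} (ρ : ι → κ) (v : κ), Definable fun I e => F I (fun i => e (ρ i)) (e v))
    {κ : Type} (ρ : ι → κ) (t a b : κ) :
    Definable fun I e => Reach I.G (F I fun i => e (ρ i)) (e t) d (e a) (e b) := by
  induction d generalizing κ with
  | zero => exact eq a b
  | succ d ih =>
    exact (eq a b).or (ex (P := fun I e z => I.G.Adj (e a) z ∧ F I (fun i => e (ρ i)) z ∧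
      z ≠ e t ∧ Reach I.G (F I fun i => e (ρ i)) (e t) d z (e b))
      ((adj _ _).and ((hF _ _).and ((ne _ _).and (ih (fun i => some (ρ i)) _ _ _)))))

theorem free (r v : ι) (w : Fin m → ι) :
    Definable fun I e => Free I.G (e r) (fun j => e (w j)) (e v) :=
  (ne v r).and (allFin fun j => (ne v (w j)).and (adj v (w j)).not)

theorem sim (u v : ι) : Definable fun I e => Sim I.G (e u) (e v) := (eq u v).or (adj u v)

theorem pair (r a b : ι) (w : Fin m → ι) :
    Definable fun I e => Pair I.G I.T (e r) (fun j => e (w j)) (e a) (e b) :=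
  (free r a w).and ((free r b w).and ((adj a b).and ((adj a r).and ((adj b r).and
    ((memT a).or ((memT b).or (memT r))))).not))

theorem main (r v : ι) (w : Fin m → ι) :
    Definable fun I e => Main I.G I.T (e r) (fun j => e (w j)) (e v) :=
  (free r v w).and ((memT v).not.and ((memT r).imp ((adj v r).imp (all
    (P := fun I e u => Free I.G (e r) (fun j => e (w j)) u → u ∉ I.T → I.G.Adj u (e r) →
      Sim I.G u (e v) → e v ≤ u)
    ((free _ _ _).imp ((memT _).not.imp ((adj _ _).imp ((sim _ _).imp (le _ _)))))))))

theorem big (r v : ι) (w : Fin m → ι) :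
    Definable fun I e => Big I.G I.T (e r) (fun j => e (w j)) (e v) :=
  ex (P := fun I e a => ∃ b, Main I.G I.T (e r) (fun j => e (w j)) a ∧
    Main I.G I.T (e r) (fun j => e (w j)) b ∧ a ≠ b ∧ Sim I.G a (e v) ∧ Sim I.G b (e v))
    (ex (P := fun I e b => Main I.G I.T (e (some r)) (fun j => e (some (w j))) (e none) ∧
      Main I.G I.T (e (some r)) (fun j => e (some (w j))) b ∧ e none ≠ b ∧
      Sim I.G (e none) (e (some v)) ∧ Sim I.G b (e (some v)))
    ((main _ _ _).and ((main _ _ _).and ((ne _ _).and ((sim _ _).and (sim _ _))))))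

theorem first (r a b : ι) (w : Fin m → ι) :
    Definable fun I e => First I.G I.T (e r) (fun j => e (w j)) (e a) (e b) :=
  (pair r a b w).and (all (P := fun I e a' => ∀ b', Pair I.G I.T (e r) (fun j => e (w j)) a' b' →
    Sim I.G a' (e a) → e a < a' ∨ (e a = a' ∧ e b ≤ b'))
    (all (P := fun I e b' => Pair I.G I.T (e (some r)) (fun j => e (some (w j))) (e none) b' →
      Sim I.G (e none) (e (some a)) →
        e (some a) < e none ∨ (e (some a) = e none ∧ e (some b) ≤ b'))
    ((pair _ _ _ _).imp ((sim _ _).imp ((lt _ _).or ((eq _ _).and (le _ _)))))))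

theorem sel (r v : ι) (w : Fin m → ι) :
    Definable fun I e => Sel I.G I.T (e r) (fun j => e (w j)) (e v) :=
  (free r v w).and (((big r v w).and (main r v w)).or (((big r v w).not.and
    (ex (P := fun I e u => First I.G I.T (e r) (fun j => e (w j)) (e v) u ∨
      First I.G I.T (e r) (fun j => e (w j)) u (e v)) ((first _ _ _ _).or (first _ _ _ _)))).or
    ((big r v w).not.and ((all (P := fun I e a => ∀ b, Pair I.G I.T (e r) (fun j => e (w j)) a b →
      ¬ Sim I.G a (e v)) (all (P := fun I e b => Pair I.G I.T (e (some r))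
        (fun j => e (some (w j))) (e none) b → ¬ Sim I.G (e none) (e (some v)))
        ((pair _ _ _ _).imp (sim _ _).not))).and
      (all (P := fun I e u => Free I.G (e r) (fun j => e (w j)) u → Sim I.G u (e v) → e v ≤ u)
        ((free _ _ _).imp ((sim _ _).imp (le _ _))))))))

theorem kept (r v : ι) (w : Fin m → ι) :
    Definable fun I e => Kept I.G I.T (e r) (fun j => e (w j)) (e v) :=
  (eq v r).or ((exFin fun j => eq v (w j)).or (sel r v w))

theorem all₃ {P : ∀ I : SFVSInstance, (ι → Fin I.n) → Fin I.n → Fin I.n → Fin I.n → Prop}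
    (hP : ∀ {κ : Type} (ρ : ι → κ) (x y z : κ),
      Definable fun I e => P I (fun i => e (ρ i)) (e x) (e y) (e z)) :
    Definable fun I e => ∀ x y z, P I e x y z :=
  all (P := fun I e x => ∀ y z, P I e x y z) <|
    all (P := fun I e y => ∀ z, P I (fun i => e (some i)) (e none) y z) <|
      all (P := fun I e z => P I (fun i => e (some (some i))) (e (some none)) (e none) z) <|
        hP _ _ _ _

end Definable

/-! ### The two kinds of solutions and the defining sentence -/

/-- The complement of `T`, changed at the vertices of `x`. -/
def Flip {V : Type*} (T : Finset V) {m : ℕ} (x : Fin m → V) (v : V) : Prop :=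
  (v ∈ T ∧ ∃ j, v = x j) ∨ (v ∉ T ∧ ∀ j, v ≠ x j)

/-- The set `Flip I.T x` solves the instance, as far as cycles of bounded length are concerned. -/
def SmallSolution (I : SFVSInstance) (d : ℕ) {m : ℕ} (x : Fin m → Fin I.n) : Prop :=
  (∀ t a b, t ∈ I.T → Flip I.T x t → Flip I.T x a → Flip I.T x b → a ≠ b → I.G.Adj t a →
    I.G.Adj t b → ¬ Reach I.G (Flip I.T x) t d a b) ∧ {v | ¬ Flip I.T x v}.ncard ≤ I.k

/-- The set of the kept vertices for the guess `r, w` solves the instance. -/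
def LargeSolution (I : SFVSInstance) (r : Fin I.n) {m : ℕ} (w : Fin m → Fin I.n) : Prop :=
  P3Free I.G (fun v => Kept I.G I.T r w v ∧ v ≠ r) ∧ NoTTriangle I.G I.T (Kept I.G I.T r w) ∧
    {v | ¬ Kept I.G I.T r w v}.ncard ≤ I.k

namespace Definable

variable {ι : Type} {m : ℕ}

theorem flip (v : ι) (x : Fin m → ι) : Definable fun I e => Flip I.T (fun j => e (x j)) (e v) :=
  ((memT v).and (exFin fun j => eq v (x j))).or ((memT v).not.and (allFin fun j => ne v (x j)))

theorem smallSolution (d : ℕ) (x : Fin m → ι) :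
    Definable fun I e => SmallSolution I d fun j => e (x j) :=
  (all₃ (P := fun I e t a b => t ∈ I.T → Flip I.T (fun j => e (x j)) t →
    Flip I.T (fun j => e (x j)) a → Flip I.T (fun j => e (x j)) b → a ≠ b → I.G.Adj t a →
    I.G.Adj t b → ¬ Reach I.G (Flip I.T fun j => e (x j)) t d a b) fun ρ t a b =>
    (memT _).imp ((flip _ _).imp ((flip _ _).imp ((flip _ _).imp ((ne _ _).imp ((adj _ _).imp
      ((adj _ _).imp (reach (F := fun I e v => Flip I.T (fun j => e (x j)) v) d
        (fun ρ v => flip v fun j => ρ (x j)) ρ t a b).not))))))).and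
    (few (P := fun I e v => ¬ Flip I.T (fun j => e (x j)) v) (flip _ _).not)

theorem largeSolution (r : ι) (w : Fin m → ι) :
    Definable fun I e => LargeSolution I (e r) fun j => e (w j) :=
  (all₃ (P := fun I e x y z => (Kept I.G I.T (e r) (fun j => e (w j)) x ∧ x ≠ e r) →
    (Kept I.G I.T (e r) (fun j => e (w j)) y ∧ y ≠ e r) →
    (Kept I.G I.T (e r) (fun j => e (w j)) z ∧ z ≠ e r) →
    I.G.Adj x y → I.G.Adj y z → x ≠ z → I.G.Adj x z) fun _ _ _ _ =>
    ((kept _ _ _).and (ne _ _)).imp (((kept _ _ _).and (ne _ _)).imp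
      (((kept _ _ _).and (ne _ _)).imp ((adj _ _).imp ((adj _ _).imp ((ne _ _).imp
        (adj _ _))))))).and
  ((all₃ (P := fun I e x y z => Kept I.G I.T (e r) (fun j => e (w j)) x →
    Kept I.G I.T (e r) (fun j => e (w j)) y → Kept I.G I.T (e r) (fun j => e (w j)) z →
    I.G.Adj x y → I.G.Adj x z → I.G.Adj y z → x ∉ I.T) fun _ _ _ _ =>
    (kept _ _ _).imp ((kept _ _ _).imp ((kept _ _ _).imp ((adj _ _).imp ((adj _ _).imp
      ((adj _ _).imp (memT _).not)))))).and
  (few (P := fun I e v => ¬ Kept I.G I.T (e r) (fun j => e (w j)) v) (kept _ _ _).not))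

end Definable

theorem isYes_iff (I : SFVSInstance) :
    I.IsYes ↔ ∃ F : Fin I.n → Prop, NoTCycle I.G I.T F ∧ {v | ¬ F v}.ncard ≤ I.k := by
  classical
  constructor
  · rintro ⟨S, hS, hk⟩
    refine ⟨(· ∉ S), (isSubsetFVS_iff S).1 hS, ?_⟩
    rw [show {v | ¬ v ∉ S} = (S : Set (Fin I.n)) by ext; simp, Set.ncard_coe_finset]
    exact hk
  · rintro ⟨F, hF, hk⟩
    refine ⟨Finset.univ.filter fun v => ¬ F v, (isSubsetFVS_iff _).2 ?_, ?_⟩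
    · convert hF using 1
      ext v; simp
    · rw [Set.ncard_eq_toFinset_card'] at hk
      convert hk using 2
      ext v; simp

/-- Soundness of the bounded test: connecting walks can be shortened to length `2s + 2`. -/
theorem isYes_of_smallSolution {s : ℕ} {I : SFVSInstance} (hG : IsFreeOf (sP1P3 s) I.G) {m : ℕ}
    {x : Fin m → Fin I.n} (h : SmallSolution I (2 * s + 2) x) : I.IsYes :=
  (isYes_iff I).2 ⟨Flip I.T x, fun t ht hF a b ha hb hab hta htb hr =>
    h.1 t a b ht hF ha hb hab hta htb (reach_of_reflTransGen hG hr), h.2⟩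

theorem isYes_of_largeSolution {I : SFVSInstance} {r : Fin I.n} {m : ℕ}
    {w : Fin m → Fin I.n} (h : LargeSolution I r w) : I.IsYes :=
  (isYes_iff I).2 ⟨_, noTCycle_of_p3Free h.1 h.2.1, h.2.2⟩

-- Let `D` be the set of deleted vertices outside `T`. If `D` is no larger than `T ∩ F`, flipping
-- the at most `2c` vertices of their union turns the complement of `T` into `F`. Otherwise deleting
-- exactly `T` is cheaper than deleting the complement of `F`, and no flips are needed.
open Classical in
theorem exists_smallSolution {c d : ℕ} {I : SFVSInstance} {F : Fin I.n → Prop}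
    (hF : NoTCycle I.G I.T F) (hk : {v | ¬ F v}.ncard ≤ I.k) (hc : (I.T.filter F).card ≤ c) :
    ∃ m ≤ 2 * c, ∃ x : Fin m → Fin I.n, SmallSolution I d x := by
  have hcycle : ∀ {m : ℕ} {x : Fin m → Fin I.n}, NoTCycle I.G I.T (Flip I.T x) →
      ∀ t a b, t ∈ I.T → Flip I.T x t → Flip I.T x a → Flip I.T x b → a ≠ b → I.G.Adj t a →
        I.G.Adj t b → ¬ Reach I.G (Flip I.T x) t d a b :=
    fun h t a b ht hFt ha hb hab hta htb hr => h t ht hFt a b ha hb hab hta htb hr.reflTransGen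
  set D := Finset.univ.filter fun v => v ∉ I.T ∧ ¬ F v with hD
  by_cases hle : D.card ≤ (I.T.filter F).card
  · set X := I.T.filter F ∪ D with hX
    have hXc : X.card ≤ 2 * c := by
      have : X.card ≤ (I.T.filter F).card + D.card := Finset.card_union_le _ _
      omega
    let x : Fin X.card → Fin I.n := fun j => X.equivFin.symm j
    have hx : ∀ v, (∃ j, v = x j) ↔ v ∈ X := fun v =>
      ⟨fun ⟨j, hj⟩ => hj ▸ (X.equivFin.symm j).2, fun hv => ⟨X.equivFin ⟨v, hv⟩, by simp [x]⟩⟩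
    have hflip : Flip I.T x = F := by
      ext v
      have h1 : (∀ j, v ≠ x j) ↔ v ∉ X := by rw [← hx v]; simp
      rw [Flip, hx, h1]
      simp only [hX, hD, Finset.mem_union, Finset.mem_filter, Finset.mem_univ, true_and]
      tauto
    refine ⟨X.card, hXc, x, hcycle (hflip ▸ hF), ?_⟩
    rw [hflip]
    exact hk
  · have hflip : ∀ v, Flip I.T (Fin.elim0 : Fin 0 → Fin I.n) v ↔ v ∉ I.T := by
      intro v; simp [Flip]
    refine ⟨0, Nat.zero_le _, Fin.elim0, hcycle fun t ht hFt => absurd ht ((hflip t).1 hFt), ?_⟩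
    have h1 : {v | ¬ Flip I.T (Fin.elim0 : Fin 0 → Fin I.n) v} = (I.T : Set (Fin I.n)) := by
      ext v; simp [hflip]
    rw [h1, Set.ncard_coe_finset]
    have h2 : {v | ¬ F v} = ((I.T.filter fun v => ¬ F v) ∪ D : Finset (Fin I.n)) := by
      ext v; simp [hD]; tauto
    have h3 : Disjoint (I.T.filter fun v => ¬ F v) D := by
      rw [Finset.disjoint_left]
      intro v hv hv'
      simp only [hD, Finset.mem_filter] at hv hv'
      exact hv'.2.1 hv.1
    rw [h2, Set.ncard_coe_finset, Finset.card_union_of_disjoint h3] at hk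
    have := Finset.card_filter_add_card_filter_not (s := I.T) F
    omega

open Classical in
theorem exists_largeSolution {s : ℕ} {I : SFVSInstance} (hG : IsFreeOf (sP1P3 s) I.G)
    {F : Fin I.n → Prop} (hF : NoTCycle I.G I.T F) (hk : {v | ¬ F v}.ncard ≤ I.k)
    (hc : (s + 3) * (s + 3) ≤ (I.T.filter F).card) :
    ∃ r, ∃ m ≤ 2 * s, ∃ w : Fin m → Fin I.n, LargeSolution I r w := by
  obtain ⟨r, hr, hP3, L, hLc, hL, hLi⟩ := exists_center hG hF hc
  obtain ⟨W, hLW, hWc, hWF, hW⟩ := exists_closed_superset hF.noTTriangle hP3 L hL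
  let w : Fin W.card → Fin I.n := fun j => W.equivFin.symm j
  have hw : ∀ v, (∃ j, v = w j) ↔ v ∈ W := fun v =>
    ⟨fun ⟨j, hj⟩ => hj ▸ (W.equivFin.symm j).2, fun hv => ⟨W.equivFin ⟨v, hv⟩, by simp [w]⟩⟩
  have hwF : ∀ j, F (w j) ∧ w j ≠ r := fun j => hWF _ (W.equivFin.symm j).2
  have hfree : ∀ {v}, Free I.G r w v → ∀ x ∈ L, x ≠ v ∧ ¬ I.G.Adj x v := by
    intro v hv x hx
    obtain ⟨j, rfl⟩ := (hw x).2 (hLW hx)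
    exact ⟨(hv.2 j).1.symm, fun h => (hv.2 j).2 h.symm⟩
  -- The guessed vertices include `L`, so a `P₃` of free vertices is away from `L` and would
  -- complete an `sP₁ + P₃`; this holds in the whole graph, not only inside `F`.
  have hC : P3Free I.G (Free I.G r w) := by
    intro p q u hp hq hu hpq hqu hpu
    by_contra hadj
    refine not_isFreeOf (s := s) L hLc.ge hLi hpq hqu hpu hadj ?_ hG
    rintro x hx z (rfl | rfl | rfl)
    exacts [hfree hp x hx, hfree hq x hx, hfree hu x hx]
  have hcov : ∀ v, F v → v = r ∨ (∃ j, v = w j) ∨ Free I.G r w v := by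
    intro v hv
    by_cases hvr : v = r
    · exact .inl hvr
    · by_cases hvW : v ∈ W
      · exact .inr (.inl ((hw v).2 hvW))
      · refine .inr (.inr ⟨hvr, fun j => ⟨fun h => hvW ((hw v).1 ⟨j, h⟩), fun h => hvW ?_⟩⟩)
        exact hW (w j) ((hw _).1 ⟨j, rfl⟩) v hv hvr h.symm
  exact ⟨r, W.card, by omega, w, p3Free_kept hC hwF hP3,
    noTTriangle_kept hC hr (fun j => (hwF j).1) hF.noTTriangle,
    (ncard_not_kept_le hC hr hF.noTTriangle hcov).trans hk⟩

theorem isYes_iff_exists_solution {s : ℕ} {I : SFVSInstance} (hG : IsFreeOf (sP1P3 s) I.G) :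
    I.IsYes ↔ (∃ m ≤ 2 * ((s + 3) * (s + 3)), ∃ x : Fin m → Fin I.n,
      SmallSolution I (2 * s + 2) x) ∨
      ∃ r, ∃ m ≤ 2 * s, ∃ w : Fin m → Fin I.n, LargeSolution I r w := by
  classical
  constructor
  · intro h
    obtain ⟨F, hF, hk⟩ := (isYes_iff I).1 h
    rcases le_total (I.T.filter F).card ((s + 3) * (s + 3)) with hc | hc
    · exact .inl (exists_smallSolution hF hk hc)
    · exact .inr (exists_largeSolution hG hF hk hc)
  · rintro (⟨m, _, x, h⟩ | ⟨r, m, _, w, h⟩)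
    · exact isYes_of_smallSolution hG h
    · exact isYes_of_largeSolution h

/-- The sizes of the guesses and the walk length depend on `s` only, so one sentence serves all
instances. -/
theorem definable_solution (s : ℕ) : Definable (ι := Empty) fun I _ =>
    (∃ m ≤ 2 * ((s + 3) * (s + 3)), ∃ x : Fin m → Fin I.n, SmallSolution I (2 * s + 2) x) ∨
      ∃ r, ∃ m ≤ 2 * s, ∃ w : Fin m → Fin I.n, LargeSolution I r w :=
  (Definable.exLe fun _ => Definable.exTuple fun _ x => Definable.smallSolution _ x).or
    (Definable.ex (P := fun I _ r => ∃ m ≤ 2 * s, ∃ w : Fin m → Fin I.n, LargeSolution I r w)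
      (Definable.exLe fun m => Definable.exTuple
        (P := fun I e (w : Fin m → Fin I.n) => LargeSolution I (e none) w)
        fun ρ w => Definable.largeSolution (ρ none) w))

end SubsetFVS

theorem mainTheorem4 (s : ℕ) :
    PolyTimeSolvableOn SFVSInstance.encode
      (fun I => IsFreeOf (sP1P3 s) I.G) SFVSInstance.IsYes := by
  obtain ⟨φ, hφ⟩ := SubsetFVS.definable_solution s
  exact SubsetFVS.polyTimeSolvableOn_formula φ _ _ fun I hI =>
    (hφ I _).trans (SubsetFVS.isYes_iff_exists_solution hI).symm
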